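/- Let $G$ be a finite simple graph on the vertices $1,\dots,m$ ($m\ge 1$) with adjacency matrix $H=(h_{ik})$. *Dynamical system.* Let $X(t)=(x_{ij}(t))$ be the real $m\times m$ matrix function with $$x_{ij}''=\sum_{k\ne i}(x_{ij}-x_{kj})\Big(\frac1{\|x_i-x_k\|^2}-h_{ik}\Big),\qquad X(0)=I,\quad X'(0)=0,$$ where $x_i=(x_{i1},\dots,x_{im})$ and the rows $x_1,\dots,x_m$ are pairwise different at all times; $X$ may be considered on $\mathbb R$ or on any open interval $J\ni 0$. Call two rows permutation equivalent if one is a rearrangement of the other. Algorithm A1 puts the vertices $i,j$ into one class iff for every $n$ with $0\le n\le m^2$ the $i$-th and $j$-th rows of the matrix $A_n=\big(x_{ij}^{(2n)}(0)/(2n)!\big)_{i,j}$ are permutation equivalent. *Algorithm A1'.* For an $m\times m$ matrix $T$ (with entries of any kind), let $\mathrm{ren}(T)$ be the matrix of natural numbers obtained by scanning $T$ row by row and replacing each entry that occurred before by the number it got before, and each new entry by the next unused number $0,1,2,\dots$. Define matrices $C^s=(c^s_{ij})$, $D^s=(d^s_{ij})$ for $s\ge 0$ by $c^0_{ij}=0$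 if $i=j$ and $c^0_{ij}=1$ if $i\ne j$; $D^s=\mathrm{ren}(P)$, where $P_{ij}$ is the lexicographically sorted list of the pairs $(c^s_{il},c^s_{jl})$, $1\le l\le m$; and $C^{s+1}=\mathrm{ren}(T)$, where $T_{ij}$ is the lexicographically sorted list of the tuples $(c^s_{ij},c^s_{kj},d^s_{ik},h_{ik})$, $1\le k\le m$. Algorithm A1' computes $C^0,C^1,\dots$ until $C^s=C^{s+1}$, and puts $i,j$ into one class iff for every $s$ with $0\le s\le m^2$ the $i$-th and $j$-th rows of $C^s$ are permutation equivalent. Then: 1. Algorithm A1' is polynomial: there are a program for a random access machine (unit-cost addition, truncated subtraction, comparison and array access on natural numbers) and a polynomial $p$ such that for all $m$ and $G$ the program, given $m$ and $H$, halts after at most $p(m)$ steps, having computed the least $N$ with $C^N=C^{N+1}$, the matrices $C^0,\dots,C^{N+1}$ and the partition of the vertices produced by A1'. 2. The number of steps of A1' is at most $m^2$: the least $N$ with $C^N=C^{N+1}$ exists, $N+1\le m^2$, and $C^s=C^N$ for all $s\ge N$. 3. If $x_{ir}(t)$ and $x_{js}(t)$ are different functions, then there is $k$ with $0\le k\le m^2$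 and $c^k_{ir}\ne c^k_{js}$. 4. A1 is covered by A1': vertices in one class of A1' are in one class of A1, and any two vertices that are mapped to each other by an automorphism of $G$ are in one class of A1'. (So if A1 yields the automorphism partition of $G$, so does A1'.) -/

import Mathlib

namespace GraphDyn

/-! ### The dynamical system -/

/-- The right-hand side `F_H(X)` of the equations of motion: row `i` of `X` is the position of the
`i`-th point, every two points repel each other and adjacent points attract each other. -/
noncomputable def force {m : ℕ} (H X : Matrix (Fin m) (Fin m) ℝ) : Matrix (Fin m) (Fin m) ℝ :=
  fun i j => ∑ k ∈ Finset.univ.erase i,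
    (X i j - X k j) * (1 / (∑ l, (X i l - X k l) ^ 2) - H i k)

/-- `X` solves `X'' = F_H(X)`, `X(0) = I`, `X'(0) = O` on the set of times `J`, with no two points
in the same position at any time. Here `H` is the adjacency matrix of `G`. -/
def IsSolution {m : ℕ} (G : SimpleGraph (Fin m)) [DecidableRel G.Adj] (J : Set ℝ)
    (X : ℝ → Matrix (Fin m) (Fin m) ℝ) : Prop :=
  (∀ t ∈ J, ∀ i k, i ≠ k → X t i ≠ X t k) ∧
  X 0 = 1 ∧
  ∃ Y : ℝ → Matrix (Fin m) (Fin m) ℝ, Y 0 = 0 ∧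
    ∀ t ∈ J, ∀ i j,
      HasDerivAt (fun τ => X τ i j) (Y t i j) t ∧
      HasDerivAt (fun τ => Y τ i j) (force (G.adjMatrix ℝ) (X t) i j) t

/-- Two rows are permutation equivalent if one is a rearrangement of the other. -/
def RowPermEquiv {m : ℕ} {β : Type*} (r₁ r₂ : Fin m → β) : Prop :=
  ∃ π : Equiv.Perm (Fin m), ∀ l, r₁ (π l) = r₂ l

/-- The matrix `A_n` of the coefficients of `t ^ (2 * n)` in the Taylor series of `X` at `0`. -/
noncomputable def coeffMatrix {m : ℕ} (X : ℝ → Matrix (Fin m) (Fin m) ℝ) (n : ℕ) :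
    Matrix (Fin m) (Fin m) ℝ :=
  fun i j => iteratedDeriv (2 * n) (fun t => X t i j) 0 / ((2 * n).factorial : ℝ)

/-- The partition produced by the dynamical algorithm A1. -/
def SameClassA1 {m : ℕ} (X : ℝ → Matrix (Fin m) (Fin m) ℝ) (i j : Fin m) : Prop :=
  ∀ n ≤ m ^ 2, RowPermEquiv (coeffMatrix X n i) (coeffMatrix X n j)

/-! ### The symbolic algorithm A1' -/

/-- All positions `(i, j)` of an `m × m` matrix in row-by-row order. -/
def positions (m : ℕ) : List (Fin m × Fin m) :=
  (List.finRange m).product (List.finRange m)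

/-- The different entries of `T`, in the order in which a row-by-row scan meets them. -/
def scanEntries {m : ℕ} {β : Type*} [DecidableEq β] (T : Fin m → Fin m → β) : List β :=
  (positions m).foldl (fun seen p => if T p.1 p.2 ∈ seen then seen else seen ++ [T p.1 p.2]) []

/-- Replace the entries of `T` by letters in a row-by-row scan: an entry met before gets the letter
that it got before, a new entry gets the next unused letter. The letter with index `n` is coded by
the number `n`. -/
def rename {m : ℕ} {β : Type*} [DecidableEq β] (T : Fin m → Fin m → β) :
    Matrix (Fin m) (Fin m) ℕ :=
  fun i j => (scanEntries T).idxOf (T i j)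

/-- The sorted vector of the pairs `(c_{il}, c_{jl})`. -/
def pairVector {m : ℕ} (C : Matrix (Fin m) (Fin m) ℕ) (i j : Fin m) : List (ℕ ×ₗ ℕ) :=
  ((List.finRange m).map fun l => toLex (C i l, C j l)).insertionSort (· ≤ ·)

/-- The matrix `D^s` computed from `C = C^s`. -/
def distLabels {m : ℕ} (C : Matrix (Fin m) (Fin m) ℕ) : Matrix (Fin m) (Fin m) ℕ :=
  rename (pairVector C)

/-- The sorted vector of the tuples `(c_{ij}, c_{kj}, d_{ik}, h_{ik})`. -/
def tupleVector {m : ℕ} (H C : Matrix (Fin m) (Fin m) ℕ) (i j : Fin m) :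
    List (ℕ ×ₗ ℕ ×ₗ ℕ ×ₗ ℕ) :=
  ((List.finRange m).map fun k =>
    toLex (C i j, toLex (C k j, toLex (distLabels C i k, H i k)))).insertionSort (· ≤ ·)

/-- One step of the algorithm: `C^{s+1}` computed from `C = C^s`. -/
def refine {m : ℕ} (H C : Matrix (Fin m) (Fin m) ℕ) : Matrix (Fin m) (Fin m) ℕ :=
  rename (tupleVector H C)

/-- The matrices `C^s`. -/
def labels {m : ℕ} (G : SimpleGraph (Fin m)) [DecidableRel G.Adj] :
    ℕ → Matrix (Fin m) (Fin m) ℕ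
  | 0 => fun i j => if i = j then 0 else 1
  | s + 1 => refine (G.adjMatrix ℕ) (labels G s)

/-- The algorithm stops at `s`: it is the first index with `C^s = C^{s+1}`. -/
def StopsAt {m : ℕ} (G : SimpleGraph (Fin m)) [DecidableRel G.Adj] (s : ℕ) : Prop :=
  IsLeast {s | labels G s = labels G (s + 1)} s

/-- The partition produced by the symbolic algorithm A1'. -/
def SameClassA1' {m : ℕ} (G : SimpleGraph (Fin m)) [DecidableRel G.Adj] (i j : Fin m) : Prop :=
  ∀ s ≤ m ^ 2, RowPermEquiv (labels G s i) (labels G s j)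

/-! ### Programs with a step count

A random access machine, as a structured language over the natural numbers with scalar variables
and two-dimensional arrays. Every elementary operation costs one step. Addition, truncated
subtraction and comparison are the only operations, so that numbers at most double in a step and
unit costs are polynomially equivalent to Turing machine time. -/

/-- A memory: scalar variables, and arrays with two indices. -/
structure Memory where
  var : ℕ → ℕ
  arr : ℕ → ℕ → ℕ → ℕ

inductive Expr where
  | const (n : ℕ)
  | var (x : ℕ)
  | read (a : ℕ) (e₁ e₂ : Expr)
  | add (e₁ e₂ : Expr)
  | sub (e₁ e₂ : Expr)
  | eq (e₁ e₂ : Expr)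
  | lt (e₁ e₂ : Expr)

def Expr.eval (σ : Memory) : Expr → ℕ
  | .const n => n
  | .var x => σ.var x
  | .read a e₁ e₂ => σ.arr a (e₁.eval σ) (e₂.eval σ)
  | .add e₁ e₂ => e₁.eval σ + e₂.eval σ
  | .sub e₁ e₂ => e₁.eval σ - e₂.eval σ
  | .eq e₁ e₂ => if e₁.eval σ = e₂.eval σ then 1 else 0
  | .lt e₁ e₂ => if e₁.eval σ < e₂.eval σ then 1 else 0

/-- The number of operations performed in the evaluation of an expression. -/
def Expr.cost : Expr → ℕ
  | .const _ => 1
  | .var _ => 1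
  | .read _ e₁ e₂ => e₁.cost + e₂.cost + 1
  | .add e₁ e₂ => e₁.cost + e₂.cost + 1
  | .sub e₁ e₂ => e₁.cost + e₂.cost + 1
  | .eq e₁ e₂ => e₁.cost + e₂.cost + 1
  | .lt e₁ e₂ => e₁.cost + e₂.cost + 1

inductive Program where
  | skip
  | assign (x : ℕ) (e : Expr)
  | store (a : ℕ) (e₁ e₂ e : Expr)
  | seq (p q : Program)
  | ite (e : Expr) (p q : Program)
  | loop (e : Expr) (p : Program)

def Memory.setVar (σ : Memory) (x v : ℕ) : Memory :=
  { σ with var := fun y => if y = x then v else σ.var y }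

def Memory.setArr (σ : Memory) (a u v w : ℕ) : Memory :=
  { σ with arr := fun b i j => if b = a ∧ i = u ∧ j = v then w else σ.arr b i j }

/-- `Exec p σ t τ`: started in memory `σ`, the program `p` halts after exactly `t` steps in
memory `τ`. A condition holds if its value is not `0`. -/
inductive Exec : Program → Memory → ℕ → Memory → Prop
  | skip (σ : Memory) : Exec .skip σ 1 σ
  | assign (x : ℕ) (e : Expr) (σ : Memory) :
      Exec (.assign x e) σ (e.cost + 1) (σ.setVar x (e.eval σ))
  | store (a : ℕ) (e₁ e₂ e : Expr) (σ : Memory) :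
      Exec (.store a e₁ e₂ e) σ (e₁.cost + e₂.cost + e.cost + 1)
        (σ.setArr a (e₁.eval σ) (e₂.eval σ) (e.eval σ))
  | seq {p q : Program} {σ σ₁ σ₂ : Memory} {t₁ t₂ : ℕ} :
      Exec p σ t₁ σ₁ → Exec q σ₁ t₂ σ₂ → Exec (.seq p q) σ (t₁ + t₂) σ₂
  | ite_true {e : Expr} {p q : Program} {σ σ₁ : Memory} {t : ℕ} :
      e.eval σ ≠ 0 → Exec p σ t σ₁ → Exec (.ite e p q) σ (e.cost + 1 + t) σ₁
  | ite_false {e : Expr} {p q : Program} {σ σ₁ : Memory} {t : ℕ} :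
      e.eval σ = 0 → Exec q σ t σ₁ → Exec (.ite e p q) σ (e.cost + 1 + t) σ₁
  | loop_true {e : Expr} {p : Program} {σ σ₁ σ₂ : Memory} {t₁ t₂ : ℕ} :
      e.eval σ ≠ 0 → Exec p σ t₁ σ₁ → Exec (.loop e p) σ₁ t₂ σ₂ →
      Exec (.loop e p) σ (e.cost + 1 + t₁ + t₂) σ₂
  | loop_false {e : Expr} {p : Program} {σ : Memory} :
      e.eval σ = 0 → Exec (.loop e p) σ (e.cost + 1) σ

/-- The input: variable `0` holds the number of vertices and array `0` the adjacency matrix;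
the rest of the memory is `0`. -/
def inputMemory {m : ℕ} (G : SimpleGraph (Fin m)) [DecidableRel G.Adj] : Memory where
  var := fun x => if x = 0 then m else 0
  arr := fun a i j =>
    if h : a = 0 ∧ i < m ∧ j < m then G.adjMatrix ℕ ⟨i, h.2.1⟩ ⟨j, h.2.2⟩ else 0

/-- The output of the algorithm A1': variable `1` holds the index `N` at which it stops, array `1`
the whole run, that is, the matrices `C^0, …, C^{N+1}` (row `s` of the array lists the entries of
`C^s` row by row), and array `2` the partition of the vertices, as a `0`-`1` matrix. -/
def HoldsOutput {m : ℕ} (G : SimpleGraph (Fin m)) [DecidableRel G.Adj] (σ : Memory) : Prop :=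
  StopsAt G (σ.var 1) ∧
  (∀ s ≤ σ.var 1 + 1, ∀ i j : Fin m, σ.arr 1 s (i * m + j) = labels G s i j) ∧
  (∀ i j : Fin m, SameClassA1' G i j → σ.arr 2 i j = 1) ∧
  (∀ i j : Fin m, ¬ SameClassA1' G i j → σ.arr 2 i j = 0)

end GraphDyn

namespace GraphDyn

/-! ### Rearrangements -/

section Rearrangements

variable {m : ℕ} {β : Type*}

/-! The labels partition the positions `(i, j)`. Since `c^s_{ij}` is part of every tuple, each
partition refines the one before it, and since every `C^s` is in the normal form given by `rename`,
equal partitions mean equal matrices. So the number of labels grows strictly until `C^N = C^{N+1}`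
(`labelCount_lt`). It starts at one or more and cannot exceed `m ^ 2`, which gives `N + 1 ≤ m ^ 2`;
from `N` on nothing changes.

For a stable labelling consider the pairs (position, velocity) of matrices that are constant on the
label classes. The tuple of `(i, j)` determines all summands of the force on that component: a label
of `D^N` fixes a multiset of coordinate pairs, hence a distance. The first-order vector field is
therefore tangent to this linear space (`force_eq_of_labels_eq`). The initial value `(I, 0)` lies in
it because `C^0` already separates the diagonal from the rest. The field is locally Lipschitz as
long as no two rows coincide, so the solution stays in the space (`solution_mem_of_invariant`):
equal labels in `C^N` force equal components (`solution_eq_of_labels_eq`). A rearrangement that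
matches two rows of `C^N` then matches the corresponding rows of all Taylor coefficients.
Automorphisms preserve labels by induction on `s`.

For the running time, sorting and scanning are replaced by counting. Two finite families are
rearrangements of each other iff multiplicities agree, and the number given by `rename` is the
number of first occurrences before that of the entry (`idxOf_scan_eq_card`). The next matrix is thus
defined by a fixed nesting of sums over ranges of length `m`, and polynomial-time functions are
closed under such sums (`Computes.sum`). -/

theorem rowPermEquiv_iff_map_eq (f g : Fin m → β) :
    RowPermEquiv f g ↔ Finset.univ.val.map f = Finset.univ.val.map g := by
  classical
  constructor
  · rintro ⟨π, hπ⟩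
    have hg : g = f ∘ π := funext fun l => (hπ l).symm
    rw [hg, ← Multiset.map_map]
    congr 1
    simp
  · intro h
    have hc : ∀ c, Fintype.card {a // g a = c} = Fintype.card {a // f a = c} := by
      intro c
      have := congrArg (Multiset.count c) h
      rw [Multiset.count_map, Multiset.count_map] at this
      rw [Fintype.card_subtype, Fintype.card_subtype, Finset.card_def, Finset.card_def,
        Finset.filter_val, Finset.filter_val]
      simpa only [eq_comm] using this.symm
    -- Fibres over the same value have the same size; bijections between them glue to a permutation.
    refine ⟨Equiv.ofFiberEquiv fun c => Fintype.equivOfCardEq (hc c), fun l => ?_⟩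
    exact Equiv.ofFiberEquiv_map _ l

/-- Comparing multiplicities at the values of `f` alone suffices: it makes one multiset contained in
the other, and both have `m` elements. This is the form that a program can test. -/
theorem rowPermEquiv_iff_card [DecidableEq β] (f g : Fin m → β) :
    RowPermEquiv f g ↔ ∀ l, (Finset.univ.filter fun l' => f l' = f l).card =
      (Finset.univ.filter fun l' => g l' = f l).card := by
  have key : ∀ (f : Fin m → β) (c : β), Multiset.count c (Finset.univ.val.map f) =
      (Finset.univ.filter fun l' => f l' = c).card := by
    intro f c
    rw [Multiset.count_map, Finset.card_def, Finset.filter_val]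
    simp only [eq_comm]
  rw [rowPermEquiv_iff_map_eq]
  constructor
  · intro h l
    rw [← key, ← key, h]
  · intro h
    refine Multiset.eq_of_le_of_card_le (Multiset.le_iff_count.2 fun c => ?_) (by simp)
    by_cases hc : c ∈ Finset.univ.val.map f
    · obtain ⟨l, -, rfl⟩ := Multiset.mem_map.1 hc
      rw [key, key, h]
    · rw [Multiset.count_eq_zero_of_notMem hc]
      exact Nat.zero_le _

theorem insertionSort_map_eq_iff [LinearOrder β] (f g : Fin m → β) :
    ((List.finRange m).map f).insertionSort (· ≤ ·) =
      ((List.finRange m).map g).insertionSort (· ≤ ·) ↔ RowPermEquiv f g := by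
  rw [rowPermEquiv_iff_map_eq]
  have hu : (Finset.univ : Finset (Fin m)).val = (List.finRange m : Multiset (Fin m)) := rfl
  rw [hu, Multiset.map_coe, Multiset.map_coe, Multiset.coe_eq_coe]
  constructor
  · intro h
    refine (List.perm_insertionSort (· ≤ ·) _).symm.trans ?_
    rw [h]
    exact List.perm_insertionSort _ _
  · intro h
    exact List.Perm.eq_of_pairwise (fun a b _ _ => le_antisymm)
      (List.pairwise_insertionSort _ _) (List.pairwise_insertionSort _ _)
      (((List.perm_insertionSort _ _).trans h).trans (List.perm_insertionSort _ _).symm)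

end Rearrangements

/-! ### Renaming -/

section Renaming

variable {m : ℕ} {β : Type*}

theorem map_range_mul (T : ℕ → β) (n m : ℕ) :
    (List.range (n * m)).map T =
      (List.range n).flatMap fun i => (List.range m).map fun j => T (i * m + j) := by
  induction n with
  | zero => simp
  | succ n ih =>
    rw [Nat.succ_mul, List.range_add, List.map_append, ih, List.range_succ, List.flatMap_append]
    simp [Function.comp_def]

theorem mul_add_lt (i j : Fin m) : (i : ℕ) * m + j < m * m := by
  have hi := i.2
  have hj := j.2
  nlinarith

theorem exists_mul_add_eq {q : ℕ} (hq : q < m * m) : ∃ i j : Fin m, (i : ℕ) * m + j = q := by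
  have hm : 0 < m := Nat.pos_of_ne_zero (by rintro rfl; simp at hq)
  exact ⟨⟨q / m, Nat.div_lt_of_lt_mul hq⟩, ⟨q % m, Nat.mod_lt _ hm⟩, Nat.div_add_mod' q m⟩

theorem mul_add_inj {i j k l : ℕ} (hj : j < m) (hl : l < m) (h : i * m + j = k * m + l) :
    i = k ∧ j = l := by
  have hm : 0 < m := by omega
  have h1 := congrArg (· / m) h
  have h2 := congrArg (· % m) h
  simp only [Nat.mul_add_mod', Nat.mod_eq_of_lt hj, Nat.mod_eq_of_lt hl] at h2
  subst h2
  exact ⟨Nat.eq_of_mul_eq_mul_right hm (by omega), rfl⟩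

/-- The entries of a matrix as a sequence, row by row. -/
def flatten [NeZero m] (T : Fin m → Fin m → β) (q : ℕ) : β :=
  T (Fin.ofNat m (q / m)) (Fin.ofNat m (q % m))

theorem flatten_mul_add [NeZero m] (T : Fin m → Fin m → β) (i j : Fin m) :
    flatten T (i * m + j) = T i j := by
  have hm : 0 < m := Nat.pos_of_ne_zero (NeZero.ne m)
  have h1 : ((i : ℕ) * m + j) / m = i := by
    rw [Nat.add_comm, Nat.add_mul_div_right _ _ hm, Nat.div_eq_of_lt j.2, Nat.zero_add]
  have h2 : ((i : ℕ) * m + j) % m = j := by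
    rw [Nat.mul_add_mod', Nat.mod_eq_of_lt j.2]
  rw [flatten, h1, h2]
  simp

variable [DecidableEq β]

/-- The different entries of a list, in the order of their first occurrences. -/
def scan (L : List β) : List β :=
  L.foldl (fun seen x => if x ∈ seen then seen else seen ++ [x]) []

theorem scan_append_singleton (L : List β) (x : β) :
    scan (L ++ [x]) = if x ∈ scan L then scan L else scan L ++ [x] := by
  rw [scan, List.foldl_append]
  rfl

theorem mem_scan (L : List β) (x : β) : x ∈ scan L ↔ x ∈ L := by
  induction L using List.reverseRecOn with
  | nil => simp [scan]
  | append_singleton L y ih =>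
    rw [scan_append_singleton]
    split_ifs with h <;> grind

/-- The scan list grows exactly at first occurrences, so an index in it counts those that precede
`y`. A `y` that never occurs gets the length of the list, as `idxOf` does. -/
theorem idxOf_scan_eq_card (T : ℕ → β) (n : ℕ) (y : β) :
    (scan ((List.range n).map T)).idxOf y =
      ((Finset.range n).filter fun q => (∀ r < q, T r ≠ T q) ∧ ∀ r ≤ q, T r ≠ y).card := by
  induction n with
  | zero => simp [scan]
  | succ n ih =>
    have hmem : ∀ x, x ∈ scan ((List.range n).map T) ↔ ∃ r < n, T r = x := by
      intro x
      simp [mem_scan]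
    rw [List.range_succ, List.map_append, List.map_singleton, scan_append_singleton,
      Finset.range_add_one, Finset.filter_insert]
    by_cases hn : T n ∈ scan ((List.range n).map T)
    · rw [if_pos hn, ih, if_neg]
      obtain ⟨r, hr, h⟩ := (hmem _).1 hn
      exact fun h' => h'.1 r hr h
    · rw [if_neg hn]
      by_cases hy : y ∈ scan ((List.range n).map T)
      · rw [List.idxOf_append_of_mem hy, ih, if_neg]
        obtain ⟨r, hr, h⟩ := (hmem _).1 hy
        exact fun h' => h'.2 r hr.le h
      · rw [List.idxOf_append_of_notMem hy, ← List.idxOf_eq_length hy, ih]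
        by_cases hyn : T n = y
        · rw [if_neg (fun h' => h'.2 n le_rfl hyn), hyn]
          simp
        · rw [if_pos, Finset.card_insert_of_notMem (by simp)]
          · rw [List.idxOf_cons_ne _ hyn]
            simp
          · refine ⟨fun r hr h => hn ((hmem _).2 ⟨r, hr, h⟩), fun r hr h => ?_⟩
            rcases hr.lt_or_eq with hr | rfl
            · exact hy ((hmem _).2 ⟨r, hr, h⟩)
            · exact hyn h

theorem scanEntries_eq_scan (T : Fin m → Fin m → β) (T' : ℕ → β)
    (hT : ∀ i j : Fin m, T' (i * m + j) = T i j) :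
    scanEntries T = scan ((List.range (m * m)).map T') := by
  have h1 : scanEntries T = scan ((positions m).map fun p => T p.1 p.2) := by
    rw [scan, List.foldl_map]
    rfl
  rw [h1, map_range_mul]
  congr 1
  simp only [positions, List.product, List.map_flatMap, List.map_map, Function.comp_def]
  rw [← List.map_coe_finRange_eq_range, List.flatMap_map]
  simp only [List.map_map, Function.comp_def, hT]

theorem rename_eq_card (T : Fin m → Fin m → β) (T' : ℕ → β)
    (hT : ∀ i j : Fin m, T' (i * m + j) = T i j) (i j : Fin m) :
    rename T i j = ((Finset.range (m * m)).filter fun q =>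
      (∀ r < q, T' r ≠ T' q) ∧ ∀ r ≤ q, T' r ≠ T i j).card := by
  rw [rename, scanEntries_eq_scan T T' hT, idxOf_scan_eq_card]

theorem rename_eq_rename_iff (T : Fin m → Fin m → β) (i j k l : Fin m) :
    rename T i j = rename T k l ↔ T i j = T k l := by
  have : NeZero m := ⟨by rintro rfl; exact i.elim0⟩
  refine List.idxOf_inj ?_
  rw [scanEntries_eq_scan T (flatten T) (flatten_mul_add T), mem_scan, List.mem_map]
  exact ⟨i * m + j, List.mem_range.2 (mul_add_lt i j), flatten_mul_add T i j⟩

/-- A renaming depends only on which entries are equal. -/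
theorem rename_congr {γ : Type*} [DecidableEq γ] (T : Fin m → Fin m → β) (U : Fin m → Fin m → γ)
    (h : ∀ i j k l, T i j = T k l ↔ U i j = U k l) : rename T = rename U := by
  funext i j
  have : NeZero m := ⟨by rintro rfl; exact i.elim0⟩
  rw [rename_eq_card T _ (flatten_mul_add T), rename_eq_card U _ (flatten_mul_add U)]
  congr 1
  ext q
  rw [Finset.mem_filter, Finset.mem_filter]
  simp only [ne_eq, flatten, h]

/-- Renamed matrices are normal forms: by `rename_congr`, two of them with the same pattern of equal
entries coincide. -/
theorem rename_rename (T : Fin m → Fin m → β) : rename (rename T) = rename T :=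
  rename_congr _ _ (rename_eq_rename_iff T)

end Renaming

/-! ### The labels -/

section Labels

variable {m : ℕ} (G : SimpleGraph (Fin m)) [DecidableRel G.Adj]

/-- The scan meets the diagonal position `(0, 0)` first and, if `m > 1`, the off-diagonal `(0, 1)`
next, so the letters `0` and `1` are already those of a renaming. -/
theorem rename_labels_zero : rename (labels G 0) = labels G 0 := by
  funext i j
  have : NeZero m := ⟨by rintro rfl; exact i.elim0⟩
  have h0 : flatten (labels G 0) 0 = 0 := by simp [flatten, labels]
  rw [rename_eq_card _ _ (flatten_mul_add (labels G 0))]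
  by_cases hij : i = j
  · have h : labels G 0 i j = 0 := if_pos hij
    rw [h, Finset.card_eq_zero, Finset.filter_eq_empty_iff]
    exact fun q _ hq => hq.2 0 (Nat.zero_le q) h0
  · have h : labels G 0 i j = 1 := if_neg hij
    have hm : 1 < m := by
      by_contra hm
      exact hij (Fin.ext (by omega))
    have h1 : flatten (labels G 0) 1 = 1 := by
      have := flatten_mul_add (labels G 0) ⟨0, by omega⟩ ⟨1, hm⟩
      simpa [labels] using this
    rw [h, Finset.card_eq_one]
    refine ⟨0, Finset.eq_singleton_iff_unique_mem.2 ⟨?_, fun q hq => ?_⟩⟩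
    · rw [Finset.mem_filter, Finset.mem_range]
      refine ⟨by positivity, by simp, fun r hr => ?_⟩
      rw [Nat.le_zero.1 hr, h0]
      exact zero_ne_one
    · by_contra hq0
      exact (Finset.mem_filter.1 hq).2.2 1 (Nat.one_le_iff_ne_zero.2 hq0) h1

theorem rename_labels (s : ℕ) : rename (labels G s) = labels G s := by
  cases s with
  | zero => exact rename_labels_zero G
  | succ s => exact rename_rename _

variable {G}

theorem pairVector_eq_iff (C : Matrix (Fin m) (Fin m) ℕ) (i j i' j' : Fin m) :
    pairVector C i j = pairVector C i' j' ↔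
      RowPermEquiv (fun l => (C i l, C j l)) (fun l => (C i' l, C j' l)) :=
  insertionSort_map_eq_iff (fun l => toLex (C i l, C j l)) (fun l => toLex (C i' l, C j' l))

theorem distLabels_eq_iff (C : Matrix (Fin m) (Fin m) ℕ) (i j i' j' : Fin m) :
    distLabels C i j = distLabels C i' j' ↔ pairVector C i j = pairVector C i' j' :=
  rename_eq_rename_iff _ _ _ _ _

theorem tupleVector_eq_iff (H C : Matrix (Fin m) (Fin m) ℕ) (i j i' j' : Fin m) :
    tupleVector H C i j = tupleVector H C i' j' ↔
      RowPermEquiv (fun k => (C i j, C k j, distLabels C i k, H i k))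
        (fun k => (C i' j', C k j', distLabels C i' k, H i' k)) :=
  insertionSort_map_eq_iff
    (fun k => toLex (C i j, toLex (C k j, toLex (distLabels C i k, H i k))))
    (fun k => toLex (C i' j', toLex (C k j', toLex (distLabels C i' k, H i' k))))

theorem labels_succ_eq_iff (s : ℕ) (i j i' j' : Fin m) :
    labels G (s + 1) i j = labels G (s + 1) i' j' ↔
      RowPermEquiv
        (fun k => (labels G s i j, labels G s k j, distLabels (labels G s) i k, G.adjMatrix ℕ i k))
        (fun k => (labels G s i' j', labels G s k j', distLabels (labels G s) i' k,
          G.adjMatrix ℕ i' k)) :=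
  (rename_eq_rename_iff _ _ _ _ _).trans (tupleVector_eq_iff _ _ _ _ _ _)

theorem labels_eq_of_succ_eq {s : ℕ} {i j i' j' : Fin m}
    (h : labels G (s + 1) i j = labels G (s + 1) i' j') : labels G s i j = labels G s i' j' := by
  obtain ⟨π, hπ⟩ := (labels_succ_eq_iff _ _ _ _ _).1 h
  exact congrArg Prod.fst (hπ i)

theorem labels_eq_of_le {s t : ℕ} (hst : s ≤ t) {i j i' j' : Fin m}
    (h : labels G t i j = labels G t i' j') : labels G s i j = labels G s i' j' := by
  induction t, hst using Nat.le_induction with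
  | base => exact h
  | succ t _ ih => exact ih (labels_eq_of_succ_eq h)

/-- Once two consecutive matrices agree, the sequence is constant. -/
theorem labels_eq_of_stable {N : ℕ} (hN : labels G N = labels G (N + 1)) {s : ℕ} (hs : N ≤ s) :
    labels G s = labels G N := by
  induction s, hs using Nat.le_induction with
  | base => rfl
  | succ s _ ih => rw [labels, ih]; exact hN.symm

variable (G) in
/-- The number of different labels. -/
def labelCount (s : ℕ) : ℕ :=
  (Finset.univ.image fun p : Fin m × Fin m => labels G s p.1 p.2).card

/-- By refinement `C^s` is the image of `C^{s+1}` under a map `g` of labels. If the count did not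
grow, `g` would be injective on the labels in use, the two partitions would agree, and so would the
normal forms. -/
theorem labelCount_lt {s : ℕ} (h : labels G s ≠ labels G (s + 1)) :
    labelCount G s < labelCount G (s + 1) := by
  by_contra hlt
  apply h
  have hfac : ∃ g : ℕ → ℕ, ∀ p : Fin m × Fin m,
      g (labels G (s + 1) p.1 p.2) = labels G s p.1 p.2 := by
    refine ⟨Function.extend (fun p : Fin m × Fin m => labels G (s + 1) p.1 p.2)
      (fun p => labels G s p.1 p.2) 0, fun p => ?_⟩
    exact Function.FactorsThrough.extend_apply (fun p q hpq => labels_eq_of_succ_eq hpq) _ p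
  obtain ⟨g, hg⟩ := hfac
  have himg : (Finset.univ.image fun p : Fin m × Fin m => labels G s p.1 p.2) =
      (Finset.univ.image fun p : Fin m × Fin m => labels G (s + 1) p.1 p.2).image g := by
    rw [Finset.image_image]
    exact Finset.image_congr fun p _ => (hg p).symm
  have hinj := Finset.card_image_iff.1 (le_antisymm Finset.card_image_le (by
    rw [← himg]
    exact not_lt.1 hlt))
  rw [← rename_labels G s, ← rename_labels G (s + 1)]
  refine rename_congr _ _ fun i j k l => ⟨fun hs => ?_, labels_eq_of_succ_eq⟩
  refine hinj (Finset.mem_coe.2 (Finset.mem_image_of_mem _ (Finset.mem_univ (i, j))))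
    (Finset.mem_coe.2 (Finset.mem_image_of_mem _ (Finset.mem_univ (k, l)))) ?_
  rw [hg (i, j), hg (k, l)]
  exact hs

variable (G) in
theorem exists_stopsAt (hm : 0 < m) : ∃ N, StopsAt G N ∧ N + 1 ≤ m ^ 2 := by
  have hmono : ∀ k, (∀ s < k, labels G s ≠ labels G (s + 1)) → k + 1 ≤ labelCount G k := by
    intro k
    induction k with
    | zero =>
      intro _
      refine Finset.card_pos.2 ⟨_, Finset.mem_image_of_mem _ (Finset.mem_univ (⟨0, hm⟩, ⟨0, hm⟩))⟩
    | succ k ih =>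
      intro h
      have h1 := ih fun s hs => h s (by omega)
      have h2 := labelCount_lt (h k (by omega))
      omega
  have hle : ∀ k, labelCount G k ≤ m ^ 2 := fun k =>
    Finset.card_image_le.trans (by simp [sq])
  have hex : ∃ N, labels G N = labels G (N + 1) := by
    by_contra hne
    push Not at hne
    have h1 := hmono (m ^ 2) fun s _ => hne s
    have h2 := hle (m ^ 2)
    omega
  refine ⟨Nat.find hex, ⟨Nat.find_spec hex, fun s hs => Nat.find_min' hex hs⟩, ?_⟩
  exact (hmono _ fun s hs => Nat.find_min hex hs).trans (hle _)

theorem StopsAt.eq {N : ℕ} (h : StopsAt G N) {s : ℕ} (hs : N ≤ s) : labels G s = labels G N :=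
  labels_eq_of_stable h.1 hs

/-- The automorphism itself is the rearrangement, both for the pairs and for the tuples. -/
theorem labels_automorphism (φ : G ≃g G) (s : ℕ) (i j : Fin m) :
    labels G s (φ i) (φ j) = labels G s i j := by
  induction s generalizing i j with
  | zero => simp [labels]
  | succ s ih =>
    rw [labels_succ_eq_iff]
    refine ⟨φ.toEquiv, fun k => ?_⟩
    have hd : distLabels (labels G s) (φ i) (φ k) = distLabels (labels G s) i k := by
      rw [distLabels_eq_iff, pairVector_eq_iff]
      exact ⟨φ.toEquiv, fun l => Prod.ext (ih i l) (ih k l)⟩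
    have hh : G.adjMatrix ℕ (φ i) (φ k) = G.adjMatrix ℕ i k := by
      simp [SimpleGraph.adjMatrix_apply, φ.map_adj_iff]
    exact Prod.ext (ih i j) (Prod.ext (ih k j) (Prod.ext hd hh))

theorem sameClassA1'_of_automorphism {i j : Fin m} (h : ∃ φ : G ≃g G, φ i = j) :
    SameClassA1' G i j := by
  obtain ⟨φ, rfl⟩ := h
  exact fun s _ => ⟨φ.symm.toEquiv, fun l => by
    rw [← labels_automorphism φ]
    simp⟩

/-- One matrix decides: a rearrangement that matches rows of `C^N` matches those of every coarser
`C^s`, and later matrices equal `C^N`. -/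
theorem sameClassA1'_iff {N : ℕ} (hN : StopsAt G N) (hle : N ≤ m ^ 2) (i j : Fin m) :
    SameClassA1' G i j ↔ RowPermEquiv (labels G N i) (labels G N j) := by
  refine ⟨fun h => h N hle, fun ⟨π, hπ⟩ s _ => ⟨π, fun l => ?_⟩⟩
  rcases le_total s N with h | h
  · exact labels_eq_of_le h (hπ l)
  · rw [hN.eq h, hπ]

end Labels

/-! ### Invariant subspaces of differential equations -/

section Invariance

open Filter Topology

variable {E : Type*} [NormedAddCommGroup E] [NormedSpace ℝ E]

/-- Grönwall's inequality to the right of `a`; the left side follows by the reflection `x ↦ 2 * a -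
x`. -/
theorem eq_zero_of_norm_deriv_le {f f' : ℝ → E} {K a δ : ℝ}
    (hf : ∀ t, |t - a| < δ → HasDerivAt f (f' t) t) (ha : f a = 0)
    (hK : ∀ t, |t - a| < δ → ‖f' t‖ ≤ K * ‖f t‖) {t : ℝ} (ht : |t - a| < δ) : f t = 0 := by
  have forward : ∀ {f f' : ℝ → E}, (∀ t, |t - a| < δ → HasDerivAt f (f' t) t) → f a = 0 →
      (∀ t, |t - a| < δ → ‖f' t‖ ≤ K * ‖f t‖) → ∀ t, a ≤ t → |t - a| < δ → f t = 0 := by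
    intro f f' hf ha hK t hat ht
    have hmem : ∀ x ∈ Set.Icc a t, |x - a| < δ := by
      rintro x ⟨hax, hxt⟩
      rw [abs_of_nonneg (by linarith)] at ht ⊢
      linarith
    exact eq_zero_of_abs_deriv_le_mul_abs_self_of_eq_zero_right (K := K)
      (fun x hx => (hf x (hmem x hx)).continuousAt.continuousWithinAt)
      (fun x hx => (hf x (hmem x (Set.Ico_subset_Icc_self hx))).hasDerivWithinAt) ha
      (fun x hx => hK x (hmem x (Set.Ico_subset_Icc_self hx))) t ⟨hat, le_rfl⟩
  rcases le_total a t with hat | hat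
  · exact forward hf ha hK t hat ht
  · have hrefl : ∀ x, |x - a| < δ → |(2 * a - x) - a| < δ := by
      intro x hx
      rwa [show 2 * a - x - a = -(x - a) by ring, abs_neg]
    have := forward (f := fun x => f (2 * a - x)) (f' := fun x => -f' (2 * a - x))
      (fun x hx => by
        simpa [Function.comp_def] using (hf _ (hrefl x hx)).scomp x ((hasDerivAt_id x).const_sub (2 * a)))
      (by rw [show 2 * a - a = a by ring, ha])
      (fun x hx => by simpa using hK _ (hrefl x hx)) (2 * a - t) (by linarith) (hrefl t ht)
    simpa using this

/-- A solution that starts in the image of a projection `P` stays there if the vector field is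
locally Lipschitz along the solution and tangent to that image. -/
theorem solution_mem_of_invariant {P : E →L[ℝ] E} {V : E → E} (hV : ∀ z, P (V (P z)) = V (P z))
    {J : Set ℝ} (hJ : IsOpen J) (hJc : IsPreconnected J) {z : ℝ → E}
    (hz : ∀ t ∈ J, HasDerivAt z (V (z t)) t)
    (hLip : ∀ t ∈ J, ∃ K, ∃ U ∈ 𝓝 (z t), LipschitzOnWith K V U)
    {a : ℝ} (ha : a ∈ J) (hPa : P (z a) = z a) {t : ℝ} (ht : t ∈ J) : P (z t) = z t := by
  set w : ℝ → E := fun t => z t - P (z t) with hw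
  have hw' : ∀ t ∈ J, HasDerivAt w (V (z t) - P (V (z t))) t := fun t ht =>
    (hz t ht).sub (P.hasFDerivAt.comp_hasDerivAt t (hz t ht))
  have hlocal : ∀ a ∈ J, w a = 0 → ∀ᶠ t in 𝓝 a, w t = 0 := by
    intro a ha hwa
    obtain ⟨K, U, hU, hKU⟩ := hLip a ha
    have hPa : P (z a) = z a := (sub_eq_zero.1 hwa).symm
    have h1 : ∀ᶠ t in 𝓝 a, z t ∈ U := (hz a ha).continuousAt.eventually hU
    -- `P` fixes `z a`, so `P (z t)` is near `z a` too and the Lipschitz bound applies to `z t` and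
    -- `P (z t)`.
    have h2 : ∀ᶠ t in 𝓝 a, P (z t) ∈ U := by
      have : ContinuousAt (fun t => P (z t)) a := P.continuous.continuousAt.comp
        (hz a ha).continuousAt
      refine this.eventually ?_
      change U ∈ 𝓝 (P (z a))
      rwa [hPa]
    obtain ⟨δ, hδ, hball⟩ := Metric.eventually_nhds_iff.1 ((hJ.eventually_mem ha).and (h1.and h2))
    have key : ∀ t, |t - a| < δ → w t = 0 := fun t ht =>
      eq_zero_of_norm_deriv_le (K := K + ‖P‖ * K) (fun t ht => hw' t (hball (y := t) ht).1) hwa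
        (fun t ht => by
          obtain ⟨-, htU, htPU⟩ := hball (y := t) ht
          have hd : ‖V (z t) - V (P (z t))‖ ≤ K * ‖w t‖ := hKU.norm_sub_le htU htPU
          -- As `P` fixes `V (P (z t))`, the derivative of `w` depends only on a difference of
          -- values of `V`, which is at most `K * ‖w t‖`.
          have heq : V (z t) - P (V (z t)) =
              (V (z t) - V (P (z t))) - P (V (z t) - V (P (z t))) := by
            rw [map_sub, hV]
            abel
          rw [heq]
          calc _ ≤ ‖V (z t) - V (P (z t))‖ + ‖P (V (z t) - V (P (z t)))‖ := norm_sub_le _ _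
            _ ≤ K * ‖w t‖ + ‖P‖ * (K * ‖w t‖) := add_le_add hd
              ((P.le_opNorm _).trans (mul_le_mul_of_nonneg_left hd (norm_nonneg _)))
            _ = _ := by ring) ht
    exact Metric.eventually_nhds_iff.2 ⟨δ, hδ, fun t ht => key t ht⟩
  -- The zero set of `w` is open in `J` by `hlocal` and closed in `J` by continuity; `J` is
  -- connected.
  have hsub : J ⊆ interior {t | w t = 0} := by
    refine hJc.subset_of_closure_inter_subset isOpen_interior
      ⟨a, ha, mem_interior_iff_mem_nhds.2 (hlocal a ha (by simp [hw, hPa]))⟩ ?_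
    rintro t ⟨htc, htJ⟩
    refine mem_interior_iff_mem_nhds.2 (hlocal t htJ ?_)
    have hmem : w t ∈ closure (Set.image w (interior {t | w t = 0})) :=
      (hw' t htJ).continuousAt.continuousWithinAt.mem_closure_image htc
    have hss : Set.image w (interior {t | w t = 0}) ⊆ {0} := by
      rintro _ ⟨x, hx, rfl⟩
      exact interior_subset (s := {t | w t = 0}) hx
    simpa using closure_mono hss hmem
  have hwt : w t = 0 := interior_subset (s := {t | w t = 0}) (hsub ht)
  exact (sub_eq_zero.1 hwt).symm

end Invariance

/-! ### Components of the solution with equal labels -/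

section Solution

open Topology

variable {m : ℕ} {G : SimpleGraph (Fin m)} [DecidableRel G.Adj]

/-- The summand `k = i` vanishes through its first factor, whatever `1 / 0` is. A sum over all
vertices can be reindexed by any permutation. -/
theorem force_eq_sum_univ (H X : Matrix (Fin m) (Fin m) ℝ) (i j : Fin m) :
    force H X i j =
      ∑ k, (X i j - X k j) * (1 / (∑ l, (X i l - X k l) ^ 2) - H i k) := by
  rw [force, ← Finset.add_sum_erase _ _ (Finset.mem_univ i)]
  simp

/-- The force respects every stable labelling. -/
theorem force_eq_of_labels_eq {N : ℕ} (hN : labels G N = labels G (N + 1))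
    {X : Matrix (Fin m) (Fin m) ℝ}
    (hX : ∀ i j k l, labels G N i j = labels G N k l → X i j = X k l) {i j i' j' : Fin m}
    (h : labels G N i j = labels G N i' j') :
    force (G.adjMatrix ℝ) X i j = force (G.adjMatrix ℝ) X i' j' := by
  have hc := h
  -- Stability turns equal labels at `N` into equal labels at `N + 1`, whose tuples match the
  -- summands one by one.
  rw [hN, labels_succ_eq_iff] at h
  obtain ⟨π, hπ⟩ := h
  rw [force_eq_sum_univ, force_eq_sum_univ, ← Equiv.sum_comp π]
  refine Finset.sum_congr rfl fun k _ => ?_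
  have hk := hπ k
  simp only [Prod.mk.injEq] at hk
  obtain ⟨-, hkj, hd, hadj⟩ := hk
  rw [distLabels_eq_iff, pairVector_eq_iff] at hd
  obtain ⟨ρ, hρ⟩ := hd
  have hsum : ∑ l, (X i l - X (π k) l) ^ 2 = ∑ l, (X i' l - X k l) ^ 2 := by
    rw [← Equiv.sum_comp ρ]
    refine Finset.sum_congr rfl fun l _ => ?_
    have hl := hρ l
    simp only [Prod.mk.injEq] at hl
    rw [hX _ _ _ _ hl.1, hX _ _ _ _ hl.2]
  have hadj' : G.adjMatrix ℝ i (π k) = G.adjMatrix ℝ i' k := by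
    have := congrArg (Nat.cast : ℕ → ℝ) hadj
    simpa [SimpleGraph.adjMatrix_apply] using this
  rw [hsum, hadj', hX _ _ _ _ hc, hX _ _ _ _ hkj]

/-- The force as a map of a normed space. -/
noncomputable def forceField (H : Matrix (Fin m) (Fin m) ℝ) :
    (Fin m → Fin m → ℝ) → Fin m → Fin m → ℝ :=
  force H

/-- Distinct rows keep the denominators away from zero; continuous differentiability then gives the
local Lipschitz bound. -/
theorem contDiffAt_forceField (H : Matrix (Fin m) (Fin m) ℝ) {X : Fin m → Fin m → ℝ}
    (hX : ∀ i k, i ≠ k → X i ≠ X k) :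
    ContDiffAt ℝ 1 (forceField H) X := by
  have hentry : ∀ i j, ContDiffAt ℝ 1 (fun X : Fin m → Fin m → ℝ => X i j) X := fun i j =>
    (contDiff_apply_apply ℝ ℝ i j).contDiffAt
  change ContDiffAt ℝ 1 (fun (X : Fin m → Fin m → ℝ) (i j : Fin m) =>
    ∑ k ∈ Finset.univ.erase i, (X i j - X k j) * (1 / (∑ l, (X i l - X k l) ^ 2) - H i k)) X
  refine contDiffAt_pi.2 fun i => contDiffAt_pi.2 fun j => ContDiffAt.sum fun k hk => ?_
  have hik : i ≠ k := (Finset.ne_of_mem_erase hk).symm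
  have hsum : ∑ l, (X i l - X k l) ^ 2 ≠ 0 := by
    intro h0
    rw [Finset.sum_eq_zero_iff_of_nonneg fun l _ => sq_nonneg _] at h0
    exact hX i k hik (funext fun l => sub_eq_zero.1 (pow_eq_zero_iff two_ne_zero |>.1
      (h0 l (Finset.mem_univ l))))
  refine ((hentry i j).sub (hentry k j)).mul (ContDiffAt.sub ?_ contDiffAt_const)
  exact contDiffAt_const.div
    (ContDiffAt.sum fun l _ => ((hentry i l).sub (hentry k l)).pow 2) hsum

theorem solution_eq_of_labels_eq {N : ℕ} (hN : labels G N = labels G (N + 1)) {J : Set ℝ}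
    (hJ : IsOpen J) (hJc : J.OrdConnected) (h0 : (0 : ℝ) ∈ J)
    {X : ℝ → Matrix (Fin m) (Fin m) ℝ} (hX : IsSolution G J X) {i r j s : Fin m}
    (h : labels G N i r = labels G N j s) {t : ℝ} (ht : t ∈ J) : X t i r = X t j s := by
  obtain ⟨hne, hX0, Y, hY0, hXY⟩ := hX
  -- `rep` chooses a position in every class of positions with equal labels
  obtain ⟨rep, hrep, hrep'⟩ : ∃ rep : Fin m × Fin m → Fin m × Fin m,
      (∀ p, labels G N (rep p).1 (rep p).2 = labels G N p.1 p.2) ∧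
      ∀ p q, labels G N p.1 p.2 = labels G N q.1 q.2 → rep p = rep q := by
    classical
    let c : Fin m × Fin m → ℕ := fun p => labels G N p.1 p.2
    have hex : ∀ p, ∃ q, c q = c p := fun p => ⟨p, rfl⟩
    let pick : ℕ → Fin m × Fin m := fun n => if h : ∃ q, c q = n then h.choose else (i, r)
    refine ⟨fun p => pick (c p), fun p => ?_, fun p q hpq => congrArg pick hpq⟩
    change c (pick (c p)) = c p
    simp only [pick, dif_pos (hex p)]
    exact (hex p).choose_spec
  let E := Fin m → Fin m → ℝ
  -- `P₁` copies to every position the entry at the representative of its class, so its image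
  -- consists of the matrices that are constant on classes.
  let P₁ : E →L[ℝ] E := ContinuousLinearMap.pi fun i => ContinuousLinearMap.pi fun j =>
    (ContinuousLinearMap.proj (rep (i, j)).2).comp
      (ContinuousLinearMap.proj (R := ℝ) (φ := fun _ : Fin m => Fin m → ℝ) (rep (i, j)).1)
  have hP₁ : ∀ x i j, P₁ x i j = x (rep (i, j)).1 (rep (i, j)).2 := fun x i j => rfl
  let P : E × E →L[ℝ] E × E := P₁.prodMap P₁
  have hP : ∀ z, P z = (P₁ z.1, P₁ z.2) := fun z => rfl
  have hfix : ∀ x : E, (∀ i j k l, labels G N i j = labels G N k l → x i j = x k l) →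
      P₁ x = x := fun x hx => funext fun i => funext fun j => hx _ _ _ _ (hrep (i, j))
  have himg : ∀ (x : E) (i j k l), labels G N i j = labels G N k l → P₁ x i j = P₁ x k l := by
    intro x i j k l h
    rw [hP₁, hP₁, hrep' (i, j) (k, l) h]
  let V : E × E → E × E := fun z => (z.2, forceField (G.adjMatrix ℝ) z.1)
  have hVinv : ∀ z, P (V (P z)) = V (P z) := fun z => Prod.ext
    (hfix _ (himg z.2))
    (hfix _ fun i j k l hl => force_eq_of_labels_eq hN (himg z.1) hl)
  let z : ℝ → E × E := fun t => (X t, Y t)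
  have hz : ∀ t ∈ J, HasDerivAt z (V (z t)) t := fun t ht =>
    HasDerivAt.prodMk
      (hasDerivAt_pi.2 fun i => hasDerivAt_pi.2 fun j => (hXY t ht i j).1)
      (hasDerivAt_pi.2 fun i => hasDerivAt_pi.2 fun j => (hXY t ht i j).2)
  have hLip : ∀ t ∈ J, ∃ K, ∃ U ∈ 𝓝 (z t), LipschitzOnWith K V U := fun t ht => by
    refine ContDiffAt.exists_lipschitzOnWith ((contDiffAt_snd (𝕜 := ℝ)).prodMk ?_)
    exact ContDiffAt.comp (𝕜 := ℝ) (n := 1) (z t) (f := Prod.fst)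
      (contDiffAt_forceField (G.adjMatrix ℝ) (X := X t) (hne t ht)) contDiffAt_fst
  -- `C^N` refines `C^0`, on whose classes the identity matrix is constant.
  have hP0 : P (z 0) = z 0 := by
    refine Prod.ext (hfix _ fun i j k l hl => ?_) (hfix _ fun i j k l _ => ?_)
    · have hl0 := labels_eq_of_le (Nat.zero_le N) hl
      simp only [labels] at hl0
      change X 0 i j = X 0 k l
      rw [hX0, Matrix.one_apply, Matrix.one_apply]
      have hiff : i = j ↔ k = l := by
        constructor <;> intro e <;> by_contra e' <;> simp [e, e'] at hl0
      simp only [hiff]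
    · rw [hY0]
      rfl
  have hPt := solution_mem_of_invariant hVinv hJ hJc.isPreconnected hz hLip h0 hP0 ht
  have hXt : P₁ (X t) = X t := congrArg Prod.fst hPt
  have := himg (X t) i r j s h
  rwa [hXt] at this

end Solution

/-! ### Running times of loops, and closure properties of polynomial-time functions -/

section Machine

/-! ### Memories and loops -/

section Loops

@[simp] theorem Memory.setVar_arr (σ : Memory) (x v : ℕ) : (σ.setVar x v).arr = σ.arr := rfl

@[simp] theorem Memory.setVar_var_self (σ : Memory) (x v : ℕ) : (σ.setVar x v).var x = v :=
  if_pos rfl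

theorem Memory.setVar_var_of_ne (σ : Memory) {x y : ℕ} (v : ℕ) (h : y ≠ x) :
    (σ.setVar x v).var y = σ.var y :=
  if_neg h

@[simp] theorem Memory.setArr_var (σ : Memory) (a u v w : ℕ) : (σ.setArr a u v w).var = σ.var :=
  rfl

theorem Memory.setArr_arr (σ : Memory) (a u v w b i j : ℕ) :
    (σ.setArr a u v w).arr b i j = if b = a ∧ i = u ∧ j = v then w else σ.arr b i j := rfl

/-- The loop `for x < var 0 do body`, whose body has to leave `x` alone. -/
def Program.forLoop (x : ℕ) (body : Program) : Program :=
  .seq (.assign x (.const 0))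
    (.loop (.lt (.var x) (.var 0)) (.seq body (.assign x (.add (.var x) (.const 1)))))

/-- A round costs the body, 4 steps for the test and 4 for the increment; the initial assignment and
the last test add 6. -/
theorem exec_forLoop {x n B : ℕ} {body : Program} (I : ℕ → Memory → Prop)
    (hn : ∀ k σ, I k σ → σ.var 0 = n) (hI : ∀ k σ v, I k σ → I k (σ.setVar x v))
    (hbody : ∀ k < n, ∀ σ, I k σ → σ.var x = k →
      ∃ t τ, Exec body σ t τ ∧ t ≤ B ∧ I (k + 1) τ ∧ τ.var x = k)
    {σ : Memory} (hσ : I 0 σ) :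
    ∃ t τ, Exec (.forLoop x body) σ t τ ∧ t ≤ n * (B + 8) + 6 ∧ I n τ := by
  have main : ∀ r k, k + r = n → ∀ σ, I k σ → σ.var x = k → ∃ t τ,
      Exec (.loop (.lt (.var x) (.var 0)) (.seq body (.assign x (.add (.var x) (.const 1)))))
        σ t τ ∧ t ≤ r * (B + 8) + 4 ∧ I n τ := by
    intro r
    induction r with
    | zero =>
      intro k hk σ hσ hxk
      refine ⟨_, σ, Exec.loop_false ?_, ?_, ?_⟩
      · simp [Expr.eval, hxk, hn k σ hσ, ← hk]
      · simp [Expr.cost]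
      · rwa [← hk]
    | succ r ih =>
      intro k hk σ hσ hxk
      obtain ⟨t₁, σ₁, he₁, ht₁, hσ₁, hx₁⟩ := hbody k (by omega) σ hσ hxk
      obtain ⟨t₂, σ₂, he₂, ht₂, hσ₂⟩ := ih (k + 1) (by omega)
        (σ₁.setVar x (Expr.eval σ₁ (.add (.var x) (.const 1)))) (hI _ _ _ hσ₁)
        (by simp [Expr.eval, hx₁])
      refine ⟨_, σ₂, Exec.loop_true ?_ (Exec.seq he₁ (Exec.assign _ _ _)) he₂, ?_, hσ₂⟩
      · have : k < n := by omega
        simp [Expr.eval, hxk, hn k σ hσ, this]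
      · simp only [Expr.cost]
        rw [Nat.succ_mul]
        omega
  obtain ⟨t, τ, he, ht, hτ⟩ := main n 0 (by omega) (σ.setVar x (Expr.eval σ (.const 0)))
    (hI _ _ _ hσ) (by simp [Expr.eval])
  refine ⟨_, τ, Exec.seq (Exec.assign _ _ _) he, ?_, hτ⟩
  simp only [Expr.cost]
  omega

end Loops

/-! ### Functions that are computable in polynomial time -/

/-- A representation of the elements `γ` of a type by memories in which only the variables below
`bound` and the arrays count. Variable `0` holds the size of `γ`. -/
structure Ctx (Γ : Type) where
  Rep : Γ → Memory → Prop
  size : Γ → ℕ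
  bound : ℕ
  bound_pos : 0 < bound
  var_zero : ∀ {γ σ}, Rep γ σ → σ.var 0 = size γ
  congr : ∀ {γ σ τ}, Rep γ σ → τ.arr = σ.arr → (∀ x < bound, τ.var x = σ.var x) → Rep γ τ

variable {Γ : Type}

/-- The representation of pairs whose second component is held by a variable. -/
@[reducible] def Ctx.push (K : Ctx Γ) : Ctx (Γ × ℕ) where
  Rep p σ := K.Rep p.1 σ ∧ σ.var K.bound = p.2
  size p := K.size p.1
  bound := K.bound + 1
  bound_pos := Nat.succ_pos _
  var_zero h := K.var_zero h.1
  congr h ha hv := ⟨K.congr h.1 ha fun x hx => hv x (by omega), (hv _ (by omega)).trans h.2⟩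

/-- `f` is computable in time polynomial in the size, with the result in any given variable `d`
that is not used by the representation, and without a change of the arrays and of the variables
below `d`. -/
def Computes (K : Ctx Γ) (f : Γ → ℕ) : Prop :=
  ∀ d, K.bound ≤ d → ∃ (prog : Program) (p : Polynomial ℕ), ∀ γ σ, K.Rep γ σ →
    ∃ t τ, Exec prog σ t τ ∧ t ≤ p.eval (K.size γ) ∧ τ.arr = σ.arr ∧
      (∀ x < d, τ.var x = σ.var x) ∧ τ.var d = f γ

open Classical in
/-- The truth value of `P`. -/
noncomputable def truth (P : Prop) : ℕ := if P then 1 else 0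

theorem truth_of {P : Prop} (h : P) : truth P = 1 := if_pos h

theorem truth_of_not {P : Prop} (h : ¬ P) : truth P = 0 := if_neg h

/-- `P` is decidable in polynomial time. -/
def Decides (K : Ctx Γ) (P : Γ → Prop) : Prop := Computes K fun γ => truth (P γ)

/-- The number of `v < n` with `P v`. -/
noncomputable def countBelow (n : ℕ) (P : ℕ → Prop) : ℕ := ∑ v ∈ Finset.range n, truth (P v)

variable {K : Ctx Γ}

theorem Computes.congr {f g : Γ → ℕ} (hf : Computes K f) (h : ∀ γ, f γ = g γ) : Computes K g :=
  (funext h : f = g) ▸ hf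

/-- Weakening: `Ctx.push` binds a loop variable, which `f` ignores. -/
theorem Computes.push {f : Γ → ℕ} (hf : Computes K f) : Computes K.push fun p => f p.1 := by
  intro d hd
  obtain ⟨prog, p, h⟩ := hf d (by simp only at hd; omega)
  exact ⟨prog, p, fun γ σ hσ => h γ.1 σ hσ.1⟩

theorem computes_of_expr {f : Γ → ℕ} (e : Expr) (he : ∀ γ σ, K.Rep γ σ → e.eval σ = f γ) :
    Computes K f := fun d _ =>
  ⟨.assign d e, .C (e.cost + 1), fun γ σ hσ => ⟨_, _, Exec.assign _ _ _, by simp, rfl,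
    fun x hx => Memory.setVar_var_of_ne _ _ hx.ne, by simp [he γ σ hσ]⟩⟩

theorem computes_const (n : ℕ) : Computes K fun _ => n :=
  computes_of_expr (.const n) fun _ _ _ => rfl

theorem computes_top : Computes K.push fun p => p.2 :=
  computes_of_expr (.var K.bound) fun _ _ h => h.2

/-- The second value goes to `d + 1`, so that its computation leaves the first one in `d` intact. -/
theorem Computes.binary {f g r : Γ → ℕ} (hf : Computes K f) (hg : Computes K g) (e : ℕ → Expr)
    (he : ∀ d γ σ, K.Rep γ σ → σ.var d = f γ → σ.var (d + 1) = g γ → (e d).eval σ = r γ) :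
    Computes K r := by
  intro d hd
  obtain ⟨prog₁, p₁, h₁⟩ := hf d hd
  obtain ⟨prog₂, p₂, h₂⟩ := hg (d + 1) (by omega)
  refine ⟨.seq prog₁ (.seq prog₂ (.assign d (e d))), p₁ + p₂ + .C ((e d).cost + 1),
    fun γ σ hσ => ?_⟩
  obtain ⟨t₁, σ₁, he₁, ht₁, ha₁, hv₁, hd₁⟩ := h₁ γ σ hσ
  have hσ₁ : K.Rep γ σ₁ := K.congr hσ ha₁ fun x hx => hv₁ x (by omega)
  obtain ⟨t₂, σ₂, he₂, ht₂, ha₂, hv₂, hd₂⟩ := h₂ γ σ₁ hσ₁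
  have hσ₂ : K.Rep γ σ₂ := K.congr hσ₁ ha₂ fun x hx => hv₂ x (by omega)
  refine ⟨_, _, Exec.seq he₁ (Exec.seq he₂ (Exec.assign _ _ _)), ?_, ?_, fun x hx => ?_, ?_⟩
  · simp only [Polynomial.eval_add, Polynomial.eval_C]
    omega
  · rw [Memory.setVar_arr, ha₂, ha₁]
  · rw [Memory.setVar_var_of_ne _ _ hx.ne, hv₂ x (by omega), hv₁ x hx]
  · rw [Memory.setVar_var_self]
    exact he d γ σ₂ hσ₂ ((hv₂ d (by omega)).trans hd₁) hd₂

theorem Computes.add {f g : Γ → ℕ} (hf : Computes K f) (hg : Computes K g) :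
    Computes K fun γ => f γ + g γ :=
  hf.binary hg (fun d => .add (.var d) (.var (d + 1))) fun d γ σ _ h₁ h₂ => by
    simp [Expr.eval, h₁, h₂]

theorem Computes.sum {m : Γ → ℕ} (hm : ∀ γ, m γ = K.size γ) {f : Γ → ℕ → ℕ}
    (hf : Computes K.push fun p => f p.1 p.2) :
    Computes K fun γ => ∑ v ∈ Finset.range (m γ), f γ v := by
  intro d hd
  have hb := K.bound_pos
  set b := K.bound with hbdef
  obtain ⟨prog, p, h⟩ := hf (d + 3) (by simp only; omega)
  let body : Program := .seq prog (.assign (d + 1) (.add (.var (d + 1)) (.var (d + 3))))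
  -- The loop variable `b` may lie below `d` and must then be preserved: it is saved in `d + 2` and
  -- restored. The sum accumulates in `d + 1`, and `d + 3` receives the summands.
  refine ⟨.seq (.assign (d + 2) (.var b)) (.seq (.assign (d + 1) (.const 0))
    (.seq (.forLoop b body) (.seq (.assign b (.var (d + 2))) (.assign d (.var (d + 1)))))),
    .X * (p + .C 12) + .C 14, fun γ σ hσ => ?_⟩
  let I : ℕ → Memory → Prop := fun k ρ => ρ.arr = σ.arr ∧
    ρ.var (d + 1) = ∑ v ∈ Finset.range k, f γ v ∧ ρ.var (d + 2) = σ.var b ∧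
    ∀ x < d, x ≠ b → ρ.var x = σ.var x
  have hRep : ∀ k ρ, I k ρ → K.Rep γ ρ := fun k ρ hρ =>
    K.congr hσ hρ.1 fun x hx => hρ.2.2.2 x (by omega) (by omega)
  have hstart : I 0 ((σ.setVar (d + 2) (σ.var b)).setVar (d + 1) 0) := by
    refine ⟨rfl, by simp, ?_, fun x hx _ => ?_⟩
    · rw [Memory.setVar_var_of_ne _ _ (by omega), Memory.setVar_var_self]
    · rw [Memory.setVar_var_of_ne _ _ (by omega), Memory.setVar_var_of_ne _ _ (by omega)]
  obtain ⟨t, τ, he, ht, harr, hacc, hsave, hvar⟩ := exec_forLoop (x := b) (n := K.size γ)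
    (B := p.eval (K.size γ) + 4) (body := body) I
    (fun k ρ hρ => K.var_zero (hRep k ρ hρ))
    (fun k ρ v hρ => by
      obtain ⟨h1, h2, h3, h4⟩ := hρ
      refine ⟨h1, ?_, ?_, fun x hx hxb => ?_⟩
      · rwa [Memory.setVar_var_of_ne _ _ (by omega)]
      · rwa [Memory.setVar_var_of_ne _ _ (by omega)]
      · rw [Memory.setVar_var_of_ne _ _ hxb, h4 x hx hxb])
    (fun k _ ρ hρ hkb => by
      obtain ⟨t, τ, he, ht, ha, hv, hd'⟩ := h (γ, k) ρ ⟨hRep k ρ hρ, hkb⟩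
      obtain ⟨h1, h2, h3, h4⟩ := hρ
      refine ⟨_, _, Exec.seq he (Exec.assign _ _ _), ?_, ⟨?_, ?_, ?_, fun x hx hxb => ?_⟩, ?_⟩
      · simp only [Expr.cost] at ht ⊢
        omega
      · rw [Memory.setVar_arr, ha, h1]
      · rw [Memory.setVar_var_self, Finset.sum_range_succ]
        simp only [Expr.eval]
        rw [hd', hv (d + 1) (by omega), h2]
      · rw [Memory.setVar_var_of_ne _ _ (by omega), hv _ (by omega), h3]
      · rw [Memory.setVar_var_of_ne _ _ (by omega), hv _ (by omega), h4 x hx hxb]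
      · rw [Memory.setVar_var_of_ne _ _ (by omega), hv _ (by omega), hkb])
    hstart
  refine ⟨_, _, Exec.seq (Exec.assign _ _ _) (Exec.seq (Exec.assign _ _ _)
    (Exec.seq he (Exec.seq (Exec.assign _ _ _) (Exec.assign _ _ _)))), ?_, ?_, ?_, ?_⟩
  · change t ≤ K.size γ * (p.eval (K.size γ) + 12) + 6 at ht
    simp only [Expr.cost, Polynomial.eval_add, Polynomial.eval_mul, Polynomial.eval_X,
      Polynomial.eval_C]
    omega
  · simpa using harr
  · intro x hx
    rw [Memory.setVar_var_of_ne _ _ hx.ne]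
    by_cases hxb : x = b
    · rw [hxb, Memory.setVar_var_self]
      exact hsave
    · rw [Memory.setVar_var_of_ne _ _ hxb, hvar x hx hxb]
  · rw [Memory.setVar_var_self]
    simp only [Expr.eval]
    rw [Memory.setVar_var_of_ne _ _ (by omega), hacc, hm]

/-- The machine has no multiplication; a product with the size is a repeated addition. -/
theorem Computes.mul_size {m : Γ → ℕ} (hm : ∀ γ, m γ = K.size γ) {f : Γ → ℕ}
    (hf : Computes K f) : Computes K fun γ => f γ * m γ :=
  (Computes.sum (f := fun γ _ => f γ) hm hf.push).congr fun γ => by simp [mul_comm]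

theorem Decides.congr {P Q : Γ → Prop} (hP : Decides K P) (h : ∀ γ, P γ ↔ Q γ) : Decides K Q :=
  (funext fun γ => propext (h γ) : P = Q) ▸ hP

theorem Computes.eq {f g : Γ → ℕ} (hf : Computes K f) (hg : Computes K g) :
    Decides K fun γ => f γ = g γ :=
  hf.binary hg (fun d => .eq (.var d) (.var (d + 1))) fun d γ σ _ h₁ h₂ => by
    simp [Expr.eval, h₁, h₂, truth]

theorem Computes.lt {f g : Γ → ℕ} (hf : Computes K f) (hg : Computes K g) :
    Decides K fun γ => f γ < g γ :=
  hf.binary hg (fun d => .lt (.var d) (.var (d + 1))) fun d γ σ _ h₁ h₂ => by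
    simp [Expr.eval, h₁, h₂, truth]

theorem Decides.and {P Q : Γ → Prop} (hP : Decides K P) (hQ : Decides K Q) :
    Decides K fun γ => P γ ∧ Q γ :=
  Computes.congr (Computes.lt (computes_const 1) (Computes.add hP hQ)) fun γ => by
    by_cases h₁ : P γ <;> by_cases h₂ : Q γ <;> simp [truth, h₁, h₂]

theorem Decides.not {P : Γ → Prop} (hP : Decides K P) : Decides K fun γ => ¬ P γ :=
  Computes.congr (Computes.eq hP (computes_const 0)) fun γ => by
    by_cases h : P γ <;> simp [truth, h]

theorem Decides.imp {P Q : Γ → Prop} (hP : Decides K P) (hQ : Decides K Q) :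
    Decides K fun γ => P γ → Q γ :=
  (hP.and hQ.not).not.congr fun γ => by tauto

theorem Computes.le {f g : Γ → ℕ} (hf : Computes K f) (hg : Computes K g) :
    Decides K fun γ => f γ ≤ g γ :=
  (hg.lt hf).not.congr fun _ => not_lt

theorem Decides.count {m : Γ → ℕ} (hm : ∀ γ, m γ = K.size γ) {P : Γ → ℕ → Prop}
    (hP : Decides K.push fun p => P p.1 p.2) : Computes K fun γ => countBelow (m γ) (P γ) :=
  Computes.sum (f := fun γ v => truth (P γ v)) hm hP

theorem Decides.forall_lt {m : Γ → ℕ} (hm : ∀ γ, m γ = K.size γ) {P : Γ → ℕ → Prop}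
    (hP : Decides K.push fun p => P p.1 p.2) : Decides K fun γ => ∀ v < m γ, P γ v :=
  ((Decides.count (P := fun γ v => ¬ P γ v) hm hP.not).eq (computes_const 0)).congr fun γ => by
    simp [countBelow, truth]

/-- A memory that represents `γ` holds the sequence `c γ` in a row of an array. -/
def HoldsRow (K : Ctx Γ) (c : Γ → ℕ → ℕ) : Prop :=
  ∃ (a : ℕ) (e : Expr), ∀ γ σ, K.Rep γ σ → ∀ v, σ.arr a (e.eval σ) v = c γ v

/-- A memory that represents `γ` holds the function `h γ` of two arguments in an array. -/
def HoldsArray (K : Ctx Γ) (h : Γ → ℕ → ℕ → ℕ) : Prop :=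
  ∃ a : ℕ, ∀ γ σ, K.Rep γ σ → ∀ u v, σ.arr a u v = h γ u v

theorem HoldsRow.push {c : Γ → ℕ → ℕ} (hc : HoldsRow K c) : HoldsRow K.push fun p => c p.1 := by
  obtain ⟨a, e, h⟩ := hc
  exact ⟨a, e, fun γ σ hσ => h γ.1 σ hσ.1⟩

theorem HoldsArray.push {h : Γ → ℕ → ℕ → ℕ} (hh : HoldsArray K h) :
    HoldsArray K.push fun p => h p.1 := by
  obtain ⟨a, h⟩ := hh
  exact ⟨a, fun γ σ hσ => h γ.1 σ hσ.1⟩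

theorem HoldsRow.computes {c : Γ → ℕ → ℕ} (hc : HoldsRow K c) {f : Γ → ℕ} (hf : Computes K f) :
    Computes K fun γ => c γ (f γ) := by
  obtain ⟨a, e, h⟩ := hc
  exact hf.binary (computes_const 0) (fun d => .read a e (.var d)) fun d γ σ hσ h₁ _ => by
    simp [Expr.eval, h₁, h γ σ hσ]

theorem HoldsArray.computes {h : Γ → ℕ → ℕ → ℕ} (hh : HoldsArray K h) {f g : Γ → ℕ}
    (hf : Computes K f) (hg : Computes K g) : Computes K fun γ => h γ (f γ) (g γ) := by
  obtain ⟨a, h⟩ := hh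
  exact hf.binary hg (fun d => .read a (.var d) (.var (d + 1))) fun d γ σ hσ h₁ h₂ => by
    simp [Expr.eval, h₁, h₂, h γ σ hσ]

/-- Polynomially many entries of an array can be set to computed values. -/
theorem exists_fill (K : Ctx Γ) (a : ℕ) (u v f : Γ → ℕ → ℕ → ℕ)
    (hu : Computes K.push.push fun p => u p.1.1 p.1.2 p.2)
    (hv : Computes K.push.push fun p => v p.1.1 p.1.2 p.2)
    (hf : Computes K.push.push fun p => f p.1.1 p.1.2 p.2) :
    ∃ (prog : Program) (p : Polynomial ℕ), ∀ γ σ, K.Rep γ σ →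
      (∀ i < K.size γ, ∀ j < K.size γ, ∀ i' < K.size γ, ∀ j' < K.size γ,
        u γ i j = u γ i' j' → v γ i j = v γ i' j' → i = i' ∧ j = j') →
      (∀ τ i j w, K.Rep γ τ → K.Rep γ (τ.setArr a (u γ i j) (v γ i j) w)) →
      ∃ t τ, Exec prog σ t τ ∧ t ≤ p.eval (K.size γ) ∧ K.Rep γ τ ∧
        (∀ x < K.bound, τ.var x = σ.var x) ∧
        (∀ i < K.size γ, ∀ j < K.size γ, τ.arr a (u γ i j) (v γ i j) = f γ i j) ∧
        ∀ b k l, (b = a → ∀ i < K.size γ, ∀ j < K.size γ, ¬ (k = u γ i j ∧ l = v γ i j)) →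
          τ.arr b k l = σ.arr b k l := by
  have hb := K.bound_pos
  set b := K.bound with hbdef
  obtain ⟨prog₁, p₁, h₁⟩ := hu (b + 2) (by simp only; omega)
  obtain ⟨prog₂, p₂, h₂⟩ := hv (b + 3) (by simp only; omega)
  obtain ⟨prog₃, p₃, h₃⟩ := hf (b + 4) (by simp only; omega)
  let inner : Program := .seq prog₁ (.seq prog₂ (.seq prog₃
    (.store a (.var (b + 2)) (.var (b + 3)) (.var (b + 4)))))
  refine ⟨.forLoop b (.forLoop (b + 1) inner),
    .X * ((.X * (p₁ + p₂ + p₃ + .C 12) + .C 6) + .C 8) + .C 6, fun γ σ hσ hinj hstab => ?_⟩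
  set n := K.size γ with hn
  -- `S` is the set of index pairs already treated. Injectivity of the targets (`hinj`) keeps
  -- finished entries from being overwritten, and `hstab` keeps the stores from destroying the data
  -- still to be read.
  let I : (ℕ → ℕ → Prop) → Memory → Prop := fun S ρ => K.Rep γ ρ ∧
    (∀ x < b, ρ.var x = σ.var x) ∧
    (∀ i < n, ∀ j < n, S i j → ρ.arr a (u γ i j) (v γ i j) = f γ i j) ∧
    ∀ c k l, (c = a → ∀ i < n, ∀ j < n, ¬ (k = u γ i j ∧ l = v γ i j)) →
      ρ.arr c k l = σ.arr c k l
  have hIset : ∀ S ρ x w, b ≤ x → I S ρ → I S (ρ.setVar x w) := by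
    rintro S ρ x w hx ⟨h1, h2, h3, h4⟩
    have hvar : ∀ y < b, (ρ.setVar x w).var y = ρ.var y := fun y hy =>
      Memory.setVar_var_of_ne _ _ (by omega)
    exact ⟨K.congr h1 rfl hvar, fun y hy => (hvar y hy).trans (h2 y hy), h3, h4⟩
  have hIsub : ∀ S S' ρ, (∀ i < n, ∀ j < n, S' i j → S i j) → I S ρ → I S' ρ :=
    fun S S' ρ hS ⟨h1, h2, h3, h4⟩ => ⟨h1, h2, fun i hi j hj h => h3 i hi j hj (hS i hi j hj h), h4⟩
  have hinner : ∀ i < n, ∀ j < n, ∀ S ρ, I S ρ → ρ.var b = i → ρ.var (b + 1) = j →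
      ∃ t τ, Exec inner ρ t τ ∧ t ≤ (p₁ + p₂ + p₃ + .C 4).eval n ∧
        I (fun i' j' => S i' j' ∨ i' = i ∧ j' = j) τ ∧ τ.var b = i ∧ τ.var (b + 1) = j := by
    rintro i hi j hj S ρ ⟨hR, hvar, hS, hout⟩ hρi hρj
    have hrep : ∀ {τ : Memory}, τ.arr = ρ.arr → (∀ x < b + 2, τ.var x = ρ.var x) →
        K.push.push.Rep ((γ, i), j) τ := fun ha hv => K.push.push.congr ⟨⟨hR, hρi⟩, hρj⟩ ha hv
    obtain ⟨t₁, σ₁, he₁, ht₁, ha₁, hv₁, hd₁⟩ := h₁ ((γ, i), j) ρ (hrep rfl fun _ _ => rfl)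
    obtain ⟨t₂, σ₂, he₂, ht₂, ha₂, hv₂, hd₂⟩ := h₂ ((γ, i), j) σ₁ (hrep ha₁ hv₁)
    have ha₂' : σ₂.arr = ρ.arr := ha₂.trans ha₁
    have hv₂' : ∀ x < b + 2, σ₂.var x = ρ.var x := fun x hx =>
      (hv₂ x (by omega)).trans (hv₁ x hx)
    obtain ⟨t₃, σ₃, he₃, ht₃, ha₃, hv₃, hd₃⟩ := h₃ ((γ, i), j) σ₂ (hrep ha₂' hv₂')
    have ha₃' : σ₃.arr = ρ.arr := ha₃.trans ha₂'
    have hv₃' : ∀ x < b + 2, σ₃.var x = ρ.var x := fun x hx =>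
      (hv₃ x (by omega)).trans (hv₂' x hx)
    have hx2 : σ₃.var (b + 2) = u γ i j := by
      rw [hv₃ _ (by omega), hv₂ _ (by omega), hd₁]
    have hx3 : σ₃.var (b + 3) = v γ i j := by
      rw [hv₃ _ (by omega), hd₂]
    refine ⟨_, _, Exec.seq he₁ (Exec.seq he₂ (Exec.seq he₃ (Exec.store _ _ _ _ _))), ?_, ?_⟩
    · change t₁ ≤ p₁.eval n at ht₁
      change t₂ ≤ p₂.eval n at ht₂
      change t₃ ≤ p₃.eval n at ht₃
      simp only [Expr.cost, Polynomial.eval_add, Polynomial.eval_C]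
      omega
    simp only [Expr.eval, hx2, hx3, hd₃, Memory.setArr_var]
    refine ⟨⟨?_, fun x hx => ?_, fun i' hi' j' hj' hij => ?_, fun c k l hc => ?_⟩, ?_, ?_⟩
    · exact hstab _ _ _ _ (K.congr hR ha₃' fun x hx => hv₃' x (by omega))
    · rw [Memory.setArr_var, hv₃' x (by omega), hvar x hx]
    · rw [Memory.setArr_arr]
      split_ifs with heq
      · obtain ⟨rfl, rfl⟩ := hinj i' hi' j' hj' i hi j hj heq.2.1 heq.2.2
        rfl
      · rw [ha₃']
        refine hS i' hi' j' hj' (hij.resolve_right ?_)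
        rintro ⟨rfl, rfl⟩
        exact heq ⟨rfl, rfl, rfl⟩
    · rw [Memory.setArr_arr, if_neg fun heq => hc heq.1 i hi j hj heq.2, ha₃', hout c k l hc]
    · rw [hv₃' b (by omega), hρi]
    · rw [hv₃' (b + 1) (by omega), hρj]
  obtain ⟨t, τ, he, ht, hτ⟩ := exec_forLoop (x := b) (n := n)
    (B := (Polynomial.X * (p₁ + p₂ + p₃ + .C 12) + .C 6 : Polynomial ℕ).eval n)
    (body := .forLoop (b + 1) inner)
    (fun k => I fun i _ => i < k)
    (fun k ρ hρ => K.var_zero hρ.1) (fun k ρ w hρ => hIset _ _ _ _ le_rfl hρ)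
    (fun k hk ρ hρ hρk => by
      obtain ⟨t, τ, he, ht, hτ, hτk⟩ := exec_forLoop (x := b + 1) (n := n)
        (B := (p₁ + p₂ + p₃ + .C 4 : Polynomial ℕ).eval n) (body := inner)
        (fun l τ => I (fun i j => i < k ∨ i = k ∧ j < l) τ ∧ τ.var b = k)
        (fun l τ hτ => K.var_zero hτ.1.1)
        (fun l τ w hτ => ⟨hIset _ _ _ _ (by omega) hτ.1, by
          rw [Memory.setVar_var_of_ne _ _ (by omega), hτ.2]⟩)
        (fun l hl τ hτ hτl => by
          obtain ⟨t, τ', he, ht, hI, hb', hb1⟩ := hinner k hk l hl _ τ hτ.1 hτ.2 hτl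
          refine ⟨t, τ', he, ht, ⟨hIsub _ _ _ (fun i _ j _ h => ?_) hI, hb'⟩, hb1⟩
          omega)
        (σ := ρ) ⟨hIsub _ _ _ (fun i _ j _ h => by omega) hρ, hρk⟩
      refine ⟨t, τ, he, ?_, hIsub _ _ _ (fun i _ j hj h => by omega) hτ, hτk⟩
      simp only [Polynomial.eval_add, Polynomial.eval_mul, Polynomial.eval_X,
        Polynomial.eval_C] at ht ⊢
      exact ht)
    (σ := σ) ⟨hσ, fun _ _ => rfl, fun i _ j _ h => absurd h (Nat.not_lt_zero i),
      fun _ _ _ _ => rfl⟩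
  refine ⟨t, τ, he, ?_, hτ.1, hτ.2.1, fun i hi j hj => hτ.2.2.1 i hi j hj hi, hτ.2.2.2⟩
  simp only [Polynomial.eval_add, Polynomial.eval_mul, Polynomial.eval_X,
    Polynomial.eval_C] at ht ⊢
  exact ht

end Machine

/-! ### The algorithm A1' by counting -/

section Counting

variable {m : ℕ}

theorem countBelow_eq_card {P : ℕ → Prop} {Q : Fin m → Prop} [DecidablePred Q]
    (h : ∀ l : Fin m, P l ↔ Q l) : countBelow m P = (Finset.univ.filter Q).card := by
  rw [countBelow, Finset.sum_range, Finset.card_filter]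
  refine Finset.sum_congr rfl fun l _ => ?_
  by_cases hl : Q l
  · rw [if_pos hl, truth_of ((h l).2 hl)]
  · rw [if_neg hl, truth_of_not fun hP => hl ((h l).1 hP)]

theorem forall_lt_iff {P : ℕ → Prop} {Q : Fin m → Prop} (h : ∀ l : Fin m, P l ↔ Q l) :
    (∀ l < m, P l) ↔ ∀ l, Q l :=
  ⟨fun hP l => (h l).1 (hP l l.2), fun hQ l hl => (h ⟨l, hl⟩).2 (hQ ⟨l, hl⟩)⟩

/-- The rows `i` and `j` of the matrix that `c` lists row by row are rearrangements of each
other. -/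
def RowMatch (m : ℕ) (c : ℕ → ℕ) (i j : ℕ) : Prop :=
  ∀ l < m, countBelow m (fun l' => c (i * m + l') = c (i * m + l)) =
    countBelow m (fun l' => c (j * m + l') = c (i * m + l))

/-- The vectors of pairs for the positions `(i, k)` and `(i', k')` agree. -/
def PairMatch (m : ℕ) (c : ℕ → ℕ) (i k i' k' : ℕ) : Prop :=
  ∀ l < m,
    countBelow m (fun l' => c (i * m + l') = c (i * m + l) ∧ c (k * m + l') = c (k * m + l)) =
    countBelow m (fun l' => c (i' * m + l') = c (i * m + l) ∧ c (k' * m + l') = c (k * m + l))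

/-- The vectors of tuples for the positions `(i, j)` and `(i', j')` agree. -/
def TupleMatch (m : ℕ) (h : ℕ → ℕ → ℕ) (c : ℕ → ℕ) (i j i' j' : ℕ) : Prop :=
  c (i * m + j) = c (i' * m + j') ∧ ∀ k < m,
    countBelow m (fun k' => c (k' * m + j) = c (k * m + j) ∧
      PairMatch m c i k' i k ∧ h i k' = h i k) =
    countBelow m (fun k' => c (k' * m + j') = c (k * m + j) ∧
      PairMatch m c i' k' i k ∧ h i' k' = h i k)

/-- The next label of `(i, j)`: the number of positions that carry an entry for the first time and
come before the first occurrence of the entry of `(i, j)`. -/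
noncomputable def nextLabel (m : ℕ) (h : ℕ → ℕ → ℕ) (c : ℕ → ℕ) (i j : ℕ) : ℕ :=
  ∑ a ∈ Finset.range m, countBelow m fun b =>
    (∀ a' < m, ∀ b' < m, a' * m + b' < a * m + b → ¬ TupleMatch m h c a' b' a b) ∧
    ∀ a' < m, ∀ b' < m, a' * m + b' ≤ a * m + b → ¬ TupleMatch m h c a' b' i j

variable {C H : Matrix (Fin m) (Fin m) ℕ} {c : ℕ → ℕ} {h : ℕ → ℕ → ℕ}

theorem rowMatch_iff (hc : ∀ i j : Fin m, c (i * m + j) = C i j) (i j : Fin m) :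
    RowMatch m c i j ↔ RowPermEquiv (C i) (C j) := by
  rw [rowPermEquiv_iff_card, RowMatch]
  refine forall_lt_iff fun l => ?_
  refine iff_of_eq (congrArg₂ _ (countBelow_eq_card fun l' => ?_)
    (countBelow_eq_card fun l' => ?_)) <;>
  simp only [hc]

/-- Tuples are only compared for equality, so labels of `D^s` need only be compared as well; the
program never stores `D^s`. -/
theorem pairMatch_iff (hc : ∀ i j : Fin m, c (i * m + j) = C i j) (i k i' k' : Fin m) :
    PairMatch m c i k i' k' ↔ distLabels C i k = distLabels C i' k' := by
  rw [distLabels_eq_iff, pairVector_eq_iff, rowPermEquiv_iff_card, PairMatch]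
  refine forall_lt_iff fun l => ?_
  refine iff_of_eq (congrArg₂ _ (countBelow_eq_card fun l' => ?_)
    (countBelow_eq_card fun l' => ?_)) <;>
  simp only [hc, Prod.mk.injEq]

theorem tupleMatch_iff (hc : ∀ i j : Fin m, c (i * m + j) = C i j)
    (hh : ∀ i j : Fin m, h i j = H i j) (i j i' j' : Fin m) :
    TupleMatch m h c i j i' j' ↔ tupleVector H C i j = tupleVector H C i' j' := by
  rw [tupleVector_eq_iff, TupleMatch, hc, hc]
  by_cases hC : C i j = C i' j'
  · rw [rowPermEquiv_iff_card]
    refine (and_iff_right hC).trans ?_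
    refine forall_lt_iff fun k => ?_
    refine iff_of_eq (congrArg₂ _ (countBelow_eq_card fun l' => ?_)
      (countBelow_eq_card fun l' => ?_)) <;>
    simp only [hc, hh, hC, pairMatch_iff hc, Prod.mk.injEq, true_and]
  · refine iff_of_false (fun h => hC h.1) fun ⟨π, hπ⟩ => hC ?_
    exact congrArg Prod.fst (hπ i)

theorem sum_range_mul (f : ℕ → ℕ) (n m : ℕ) :
    ∑ q ∈ Finset.range (n * m), f q =
      ∑ a ∈ Finset.range n, ∑ b ∈ Finset.range m, f (a * m + b) := by
  induction n with
  | zero => simp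
  | succ n ih => rw [Nat.succ_mul, Finset.sum_range_add, ih, Finset.sum_range_succ]

/-- This is `rename_eq_card` with every position written as `a * m + b` and every equality of sorted
vectors replaced by counting. -/
theorem nextLabel_eq (hc : ∀ i j : Fin m, c (i * m + j) = C i j)
    (hh : ∀ i j : Fin m, h i j = H i j) (i j : Fin m) :
    nextLabel m h c i j = refine H C i j := by
  have : NeZero m := ⟨by rintro rfl; exact i.elim0⟩
  have hT := flatten_mul_add (tupleVector H C)
  rw [refine, rename_eq_card _ _ hT, Finset.card_filter, sum_range_mul, nextLabel]
  refine Finset.sum_congr rfl fun a ha => Finset.sum_congr rfl fun b hb => ?_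
  have hiff : ((∀ a' < m, ∀ b' < m, a' * m + b' < a * m + b → ¬ TupleMatch m h c a' b' a b) ∧
      ∀ a' < m, ∀ b' < m, a' * m + b' ≤ a * m + b → ¬ TupleMatch m h c a' b' i j) ↔
      ((∀ r < a * m + b, flatten (tupleVector H C) r ≠ flatten (tupleVector H C) (a * m + b)) ∧
        ∀ r ≤ a * m + b, flatten (tupleVector H C) r ≠ tupleVector H C i j) := by
    have ha := Finset.mem_range.1 ha
    have hb := Finset.mem_range.1 hb
    have hab := mul_add_lt (⟨a, ha⟩ : Fin m) ⟨b, hb⟩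
    simp only at hab
    have key : ∀ i j : Fin m, ∀ a' < m, ∀ b' < m, TupleMatch m h c a' b' i j ↔
        flatten (tupleVector H C) (a' * m + b') = tupleVector H C i j := by
      intro i j a' ha' b' hb'
      have hT' := hT ⟨a', ha'⟩ ⟨b', hb'⟩
      simp only at hT'
      rw [hT']
      exact tupleMatch_iff hc hh ⟨a', ha'⟩ ⟨b', hb'⟩ i j
    have hTab : flatten (tupleVector H C) (a * m + b) = tupleVector H C ⟨a, ha⟩ ⟨b, hb⟩ :=
      hT ⟨a, ha⟩ ⟨b, hb⟩
    refine and_congr ?_ ?_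
    · rw [hTab]
      constructor
      · intro h1 r hr
        obtain ⟨a', b', rfl⟩ := exists_mul_add_eq (hr.trans hab)
        exact fun he => h1 a' a'.2 b' b'.2 hr ((key ⟨a, ha⟩ ⟨b, hb⟩ a' a'.2 b' b'.2).2 he)
      · exact fun h1 a' ha' b' hb' hlt he =>
          h1 _ hlt ((key ⟨a, ha⟩ ⟨b, hb⟩ a' ha' b' hb').1 he)
    · constructor
      · intro h1 r hr
        obtain ⟨a', b', rfl⟩ := exists_mul_add_eq (hr.trans_lt hab)
        exact fun he => h1 a' a'.2 b' b'.2 hr ((key i j a' a'.2 b' b'.2).2 he)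
      · exact fun h1 a' ha' b' hb' hlt he => h1 _ hlt ((key i j a' ha' b' hb').1 he)
  split_ifs with hfirst
  · exact truth_of (hiff.2 hfirst)
  · exact truth_of_not fun h' => hfirst (hiff.1 h')

end Counting

/-! ### Polynomial time -/

section PolynomialTime

variable {Γ : Type} {K : Ctx Γ} {m : Γ → ℕ} {c : Γ → ℕ → ℕ} {h : Γ → ℕ → ℕ → ℕ}

theorem HoldsRow.entry (hc : HoldsRow K c) (hm : ∀ γ, m γ = K.size γ) {f g : Γ → ℕ}
    (hf : Computes K f) (hg : Computes K g) : Computes K fun γ => c γ (f γ * m γ + g γ) :=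
  hc.computes ((hf.mul_size hm).add hg)

theorem decides_rowMatch (hc : HoldsRow K c) (hm : ∀ γ, m γ = K.size γ) {i j : Γ → ℕ}
    (hi : Computes K i) (hj : Computes K j) :
    Decides K fun γ => RowMatch (m γ) (c γ) (i γ) (j γ) := by
  have hm₁ : ∀ p : Γ × ℕ, m p.1 = K.push.size p := fun p => hm p.1
  have hm₂ : ∀ p : (Γ × ℕ) × ℕ, m p.1.1 = K.push.push.size p := fun p => hm p.1.1
  have hx := hc.push.push.entry hm₂ hi.push.push computes_top.push
  exact Decides.forall_lt hm (Computes.eq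
    (Decides.count hm₁ ((hc.push.push.entry hm₂ hi.push.push computes_top).eq hx))
    (Decides.count hm₁ ((hc.push.push.entry hm₂ hj.push.push computes_top).eq hx)))

theorem decides_pairMatch (hc : HoldsRow K c) (hm : ∀ γ, m γ = K.size γ) {i k i' k' : Γ → ℕ}
    (hi : Computes K i) (hk : Computes K k) (hi' : Computes K i') (hk' : Computes K k') :
    Decides K fun γ => PairMatch (m γ) (c γ) (i γ) (k γ) (i' γ) (k' γ) := by
  have hm₁ : ∀ p : Γ × ℕ, m p.1 = K.push.size p := fun p => hm p.1
  have hm₂ : ∀ p : (Γ × ℕ) × ℕ, m p.1.1 = K.push.push.size p := fun p => hm p.1.1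
  have hc₂ := hc.push.push
  have hx := hc₂.entry hm₂ hi.push.push computes_top.push
  have hy := hc₂.entry hm₂ hk.push.push computes_top.push
  exact Decides.forall_lt hm (Computes.eq
    (Decides.count hm₁ (((hc₂.entry hm₂ hi.push.push computes_top).eq hx).and
      ((hc₂.entry hm₂ hk.push.push computes_top).eq hy)))
    (Decides.count hm₁ (((hc₂.entry hm₂ hi'.push.push computes_top).eq hx).and
      ((hc₂.entry hm₂ hk'.push.push computes_top).eq hy))))

theorem decides_tupleMatch (hc : HoldsRow K c) (hh : HoldsArray K h) (hm : ∀ γ, m γ = K.size γ)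
    {i j i' j' : Γ → ℕ}
    (hi : Computes K i) (hj : Computes K j) (hi' : Computes K i') (hj' : Computes K j') :
    Decides K fun γ => TupleMatch (m γ) (h γ) (c γ) (i γ) (j γ) (i' γ) (j' γ) := by
  have hm₁ : ∀ p : Γ × ℕ, m p.1 = K.push.size p := fun p => hm p.1
  have hm₂ : ∀ p : (Γ × ℕ) × ℕ, m p.1.1 = K.push.push.size p := fun p => hm p.1.1
  have hc₂ := hc.push.push
  have hh₂ := hh.push.push
  have hk := (computes_top (K := K)).push
  have hk' := computes_top (K := K.push)
  have hx := hc₂.entry hm₂ hk hj.push.push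
  have hy := hh₂.computes hi.push.push hk
  exact ((hc.entry hm hi hj).eq (hc.entry hm hi' hj')).and (Decides.forall_lt hm (Computes.eq
    (Decides.count hm₁ (((hc₂.entry hm₂ hk' hj.push.push).eq hx).and
      ((decides_pairMatch hc₂ hm₂ hi.push.push hk' hi.push.push hk).and
        ((hh₂.computes hi.push.push hk').eq hy))))
    (Decides.count hm₁ (((hc₂.entry hm₂ hk' hj'.push.push).eq hx).and
      ((decides_pairMatch hc₂ hm₂ hi'.push.push hk' hi.push.push hk).and
        ((hh₂.computes hi'.push.push hk').eq hy))))))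

theorem computes_nextLabel (hc : HoldsRow K c) (hh : HoldsArray K h) (hm : ∀ γ, m γ = K.size γ)
    {i j : Γ → ℕ} (hi : Computes K i) (hj : Computes K j) :
    Computes K fun γ => nextLabel (m γ) (h γ) (c γ) (i γ) (j γ) := by
  have hm₁ : ∀ p : Γ × ℕ, m p.1 = K.push.size p := fun p => hm p.1
  have hm₂ : ∀ p : (Γ × ℕ) × ℕ, m p.1.1 = K.push.push.size p := fun p => hm p.1.1
  have hm₃ : ∀ p : ((Γ × ℕ) × ℕ) × ℕ, m p.1.1.1 = K.push.push.push.size p := fun p => hm p.1.1.1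
  have hm₄ : ∀ p : (((Γ × ℕ) × ℕ) × ℕ) × ℕ, m p.1.1.1.1 = K.push.push.push.push.size p :=
    fun p => hm p.1.1.1.1
  have hc₄ := hc.push.push.push.push
  have hh₄ := hh.push.push.push.push
  have ha := (computes_top (K := K)).push.push.push
  have hb := (computes_top (K := K.push)).push.push
  have ha' := (computes_top (K := K.push.push)).push
  have hb' := computes_top (K := K.push.push.push)
  have hp := (ha.mul_size hm₄).add hb
  have hp' := (ha'.mul_size hm₄).add hb'
  exact Computes.sum hm (Decides.count hm₁ (Decides.and
    (Decides.forall_lt hm₂ (Decides.forall_lt hm₃ ((hp'.lt hp).imp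
      (decides_tupleMatch hc₄ hh₄ hm₄ ha' hb' ha hb).not)))
    (Decides.forall_lt hm₂ (Decides.forall_lt hm₃ ((hp'.le hp).imp
      (decides_tupleMatch hc₄ hh₄ hm₄ ha' hb' hi.push.push.push.push
        hj.push.push.push.push).not)))))

end PolynomialTime

/-! ### The program -/

section Program

/-- What one step of the algorithm reads: the number of vertices, the index `s` of the step, the
adjacency matrix, and the entries of `C^s` row by row. -/
structure Snapshot where
  size : ℕ
  step : ℕ
  adj : ℕ → ℕ → ℕ
  row : ℕ → ℕ

/-- Snapshots in the layout of the output. -/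
@[reducible] def snapshotCtx : Ctx Snapshot where
  Rep γ σ := σ.var 0 = γ.size ∧ σ.var 1 = γ.step ∧ σ.arr 0 = γ.adj ∧ σ.arr 1 γ.step = γ.row
  size := Snapshot.size
  bound := 2
  bound_pos := Nat.two_pos
  var_zero h := h.1
  congr h ha hv := ⟨(hv 0 (by omega)).trans h.1, (hv 1 (by omega)).trans h.2.1, by
    rw [ha, h.2.2.1], by rw [ha, h.2.2.2]⟩

/-- Snapshots together with the entries of `C^{s+1}`. -/
@[reducible] def nextSnapshotCtx : Ctx (Snapshot × (ℕ → ℕ)) where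
  Rep p σ := snapshotCtx.Rep p.1 σ ∧ σ.arr 1 (p.1.step + 1) = p.2
  size p := p.1.size
  bound := 2
  bound_pos := Nat.two_pos
  var_zero h := h.1.1
  congr h ha hv := ⟨snapshotCtx.congr h.1 ha hv, by rw [ha, h.2]⟩

/-- The number of vertices alone. -/
@[reducible] def sizeCtx : Ctx ℕ where
  Rep m σ := σ.var 0 = m
  size m := m
  -- The bound also protects variable `1`, which holds the index `0` at the start.
  bound := 2
  bound_pos := Nat.two_pos
  var_zero h := h
  congr h _ hv := (hv 0 (by omega)).trans h

theorem holdsRow_snapshotCtx : HoldsRow snapshotCtx Snapshot.row :=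
  ⟨1, .var 1, fun γ σ h v => by rw [Expr.eval, h.2.1, h.2.2.2]⟩

theorem holdsArray_snapshotCtx : HoldsArray snapshotCtx Snapshot.adj :=
  ⟨0, fun γ σ h u v => by rw [h.2.2.1]⟩

theorem computes_step : Computes snapshotCtx Snapshot.step :=
  computes_of_expr (.var 1) fun _ _ h => h.2.1

/-- The memory holds the input, the index `s` and the matrices `C^0, …, C^r`. -/
def HoldsRun {m : ℕ} (G : SimpleGraph (Fin m)) [DecidableRel G.Adj] (s r : ℕ) (σ : Memory) :
    Prop :=
  σ.var 0 = m ∧ σ.var 1 = s ∧ (∀ i j : Fin m, σ.arr 0 i j = G.adjMatrix ℕ i j) ∧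
    ∀ s' ≤ r, ∀ i j : Fin m, σ.arr 1 s' (i * m + j) = labels G s' i j

theorem exists_start_program : ∃ (prog : Program) (p : Polynomial ℕ),
    ∀ (m : ℕ) (G : SimpleGraph (Fin m)) [DecidableRel G.Adj],
      ∃ t τ, Exec prog (inputMemory G) t τ ∧ t ≤ p.eval m ∧ HoldsRun G 0 0 τ := by
  have hi := (computes_top (K := sizeCtx)).push
  have hj := computes_top (K := sizeCtx.push)
  obtain ⟨prog, p, h⟩ := exists_fill sizeCtx 1 (fun _ _ _ => 0) (fun m i j => i * m + j)
    (fun _ i j => truth (¬ i = j)) (computes_const 0)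
    ((hi.mul_size fun _ => rfl).add hj) (hi.eq hj).not
  refine ⟨prog, p, fun m G _ => ?_⟩
  obtain ⟨t, τ, he, ht, h0, hv, hf, hout⟩ := h m (inputMemory G) (by simp [inputMemory])
    (fun i _ j hj i' _ j' hj' _ heq => mul_add_inj hj hj' heq) (fun τ i j w hτ => hτ)
  refine ⟨t, τ, he, ht, h0, ?_, fun i j => ?_, fun s hs i j => ?_⟩
  · rw [hv 1 (by simp)]
    simp [inputMemory]
  · rw [hout 0 i j (by simp)]
    simp [inputMemory]
  · obtain rfl := Nat.le_zero.1 hs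
    rw [hf i i.2 j j.2]
    by_cases hij : i = j
    · simp [labels, truth, hij]
    · simp [labels, truth, hij, Fin.val_inj]

theorem exists_step_program : ∃ (prog : Program) (p : Polynomial ℕ),
    ∀ (m : ℕ) (G : SimpleGraph (Fin m)) [DecidableRel G.Adj] (s : ℕ) (σ : Memory),
      HoldsRun G s s σ → ∃ t τ, Exec prog σ t τ ∧ t ≤ p.eval m ∧ HoldsRun G s (s + 1) τ ∧
        (τ.var 2 = 0 ↔ labels G s = labels G (s + 1)) := by
  have hi := (computes_top (K := snapshotCtx)).push
  have hj := computes_top (K := snapshotCtx.push)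
  obtain ⟨prog₁, p₁, h₁⟩ := exists_fill snapshotCtx 1 (fun γ _ _ => γ.step + 1)
    (fun γ i j => i * γ.size + j) (fun γ i j => nextLabel γ.size γ.adj γ.row i j)
    (computes_step.add (computes_const 1)).push.push
    ((hi.mul_size fun _ => rfl).add hj)
    (computes_nextLabel holdsRow_snapshotCtx.push.push holdsArray_snapshotCtx.push.push
      (fun _ => rfl) hi hj)
  have hrow : HoldsRow nextSnapshotCtx fun p => p.1.row :=
    ⟨1, .var 1, fun γ σ h v => by rw [Expr.eval, h.1.2.1, h.1.2.2.2]⟩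
  have hnext : HoldsRow nextSnapshotCtx fun p => p.2 :=
    ⟨1, .add (.var 1) (.const 1), fun γ σ h v => by
      rw [Expr.eval, Expr.eval, Expr.eval, h.1.2.1, h.2]⟩
  have hi' := (computes_top (K := nextSnapshotCtx)).push
  have hj' := computes_top (K := nextSnapshotCtx.push)
  have hflag : Decides nextSnapshotCtx fun p => ¬ ∀ i < p.1.size, ∀ j < p.1.size,
      p.1.row (i * p.1.size + j) = p.2 (i * p.1.size + j) :=
    (Decides.forall_lt (fun _ => rfl) (Decides.forall_lt (fun _ => rfl)
      ((hrow.push.push.entry (fun _ => rfl) hi' hj').eq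
        (hnext.push.push.entry (fun _ => rfl) hi' hj')))).not
  -- Variable `2` receives the flag that controls the main loop.
  obtain ⟨prog₂, p₂, h₂⟩ := hflag 2 le_rfl
  refine ⟨.seq prog₁ prog₂, p₁ + p₂, fun m G _ s σ ⟨hm, hs, hadj, hrun⟩ => ?_⟩
  let γ : Snapshot := ⟨m, s, σ.arr 0, σ.arr 1 s⟩
  obtain ⟨t₁, σ₁, he₁, ht₁, hR₁, hv₁, hf₁, hout₁⟩ := h₁ γ σ ⟨hm, hs, rfl, rfl⟩
    (fun i _ j hj i' _ j' hj' _ heq => mul_add_inj hj hj' heq)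
    (fun τ i j w hτ => ⟨hτ.1, hτ.2.1, by
      rw [← hτ.2.2.1]
      funext k l
      simp [Memory.setArr_arr], by
      rw [← hτ.2.2.2]
      funext l
      simp [Memory.setArr_arr]⟩)
  obtain ⟨t₂, σ₂, he₂, ht₂, ha₂, hv₂, hd₂⟩ := h₂ (γ, σ₁.arr 1 (s + 1)) σ₁ ⟨hR₁, rfl⟩
  have hnew : ∀ i j : Fin m, σ₁.arr 1 (s + 1) (i * m + j) = labels G (s + 1) i j := by
    intro i j
    rw [hf₁ i i.2 j j.2]
    exact nextLabel_eq (hrun s le_rfl) hadj i j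
  refine ⟨_, σ₂, Exec.seq he₁ he₂, ?_, ⟨?_, ?_, fun i j => ?_, fun s' hs' i j => ?_⟩, ?_⟩
  · rw [Polynomial.eval_add]
    exact Nat.add_le_add ht₁ ht₂
  · rw [hv₂ 0 (by omega), hR₁.1]
  · rw [hv₂ 1 (by omega), hR₁.2.1]
  · rw [ha₂, hR₁.2.2.1]
    exact hadj i j
  · rw [ha₂]
    rcases hs'.lt_or_eq with hlt | rfl
    · rw [hout₁ 1 s' _ fun _ k _ l _ h => by simp only [γ] at h; omega]
      exact hrun s' (by omega) i j
    · exact hnew i j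
  · rw [hd₂]
    have hiff : (∀ i < m, ∀ j < m, σ.arr 1 s (i * m + j) = σ₁.arr 1 (s + 1) (i * m + j)) ↔
        labels G s = labels G (s + 1) := by
      rw [← Matrix.ext_iff]
      refine forall_lt_iff fun i => forall_lt_iff fun j => ?_
      rw [hnew, hrun s le_rfl]
    by_cases heq : labels G s = labels G (s + 1)
    · exact iff_of_true (truth_of_not (not_not.2 (hiff.2 heq))) heq
    · refine iff_of_false (fun h0 => Nat.one_ne_zero ?_) heq
      exact (truth_of fun h => heq (hiff.1 h)).symm.trans h0

/-- Only the last matrix is consulted, which `sameClassA1'_iff` justifies. -/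
theorem exists_partition_program : ∃ (prog : Program) (p : Polynomial ℕ),
    ∀ (m : ℕ) (G : SimpleGraph (Fin m)) [DecidableRel G.Adj] (s : ℕ) (σ : Memory),
      HoldsRun G s (s + 1) σ → ∃ t τ, Exec prog σ t τ ∧ t ≤ p.eval m ∧ HoldsRun G s (s + 1) τ ∧
        ∀ i j : Fin m, τ.arr 2 i j = truth (RowPermEquiv (labels G s i) (labels G s j)) := by
  have hi := (computes_top (K := snapshotCtx)).push
  have hj := computes_top (K := snapshotCtx.push)
  obtain ⟨prog, p, h⟩ := exists_fill snapshotCtx 2 (fun _ i _ => i) (fun _ _ j => j)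
    (fun γ i j => truth (RowMatch γ.size γ.row i j)) hi hj
    (decides_rowMatch holdsRow_snapshotCtx.push.push (fun _ => rfl) hi hj)
  refine ⟨prog, p, fun m G _ s σ ⟨hm, hs, hadj, hrun⟩ => ?_⟩
  obtain ⟨t, τ, he, ht, hR, hv, hf, hout⟩ := h ⟨m, s, σ.arr 0, σ.arr 1 s⟩ σ ⟨hm, hs, rfl, rfl⟩
    (fun _ _ _ _ _ _ _ _ h₁ h₂ => ⟨h₁, h₂⟩)
    (fun τ i j w hτ => ⟨hτ.1, hτ.2.1, by
      rw [← hτ.2.2.1]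
      funext k l
      simp [Memory.setArr_arr], by
      rw [← hτ.2.2.2]
      funext l
      simp [Memory.setArr_arr]⟩)
  refine ⟨t, τ, he, ht, ⟨hR.1, hR.2.1, fun i j => ?_, fun s' hs' i j => ?_⟩, fun i j => ?_⟩
  · rw [hR.2.2.1]
    exact hadj i j
  · rw [hout 1 s' _ (by simp)]
    exact hrun s' hs' i j
  · rw [hf i i.2 j j.2, propext (rowMatch_iff (hrun s (by omega)) i j)]

/-- The program also has to handle `m = 0`, where `N = 0` and the sharper bound `N + 1 ≤ m ^ 2`
fails. -/
theorem exists_stopsAt_le {m : ℕ} (G : SimpleGraph (Fin m)) [DecidableRel G.Adj] :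
    ∃ N, StopsAt G N ∧ N ≤ m ^ 2 := by
  rcases Nat.eq_zero_or_pos m with rfl | hm
  · exact ⟨0, ⟨Subsingleton.elim _ _, fun _ _ => Nat.zero_le _⟩, Nat.zero_le _⟩
  · obtain ⟨N, hN, hle⟩ := exists_stopsAt G hm
    exact ⟨N, hN, by omega⟩

theorem exists_program : ∃ (prog : Program) (p : Polynomial ℕ),
    ∀ (m : ℕ) (G : SimpleGraph (Fin m)) [DecidableRel G.Adj],
      ∃ (t : ℕ) (σ : Memory),
        Exec prog (inputMemory G) t σ ∧ t ≤ p.eval m ∧ HoldsOutput G σ := by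
  obtain ⟨start, p₁, h₁⟩ := exists_start_program
  obtain ⟨step, p₂, h₂⟩ := exists_step_program
  obtain ⟨final, p₃, h₃⟩ := exists_partition_program
  let body : Program := .seq (.assign 1 (.add (.var 1) (.const 1))) step
  refine ⟨.seq start (.seq step (.seq (.loop (.var 2) body) final)),
    p₁ + p₂ + (.X ^ 2 * (p₂ + .C 6) + .C 2) + p₃, fun m G _ => ?_⟩
  obtain ⟨N, hN, hNm⟩ := exists_stopsAt_le G
  -- Here `r` is the number of rounds left. The flag tells whether `C^s` is stable, so by minimality
  -- of `N` the loop ends exactly at `s = N`. A round costs one step program plus 2 for the test and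
  -- 4 for the increment.
  have hloop : ∀ r s, s + r = N → ∀ σ, HoldsRun G s (s + 1) σ →
      (σ.var 2 = 0 ↔ labels G s = labels G (s + 1)) →
      ∃ t τ, Exec (.loop (.var 2) body) σ t τ ∧ t ≤ r * (p₂.eval m + 6) + 2 ∧
        HoldsRun G N (N + 1) τ := by
    intro r
    induction r with
    | zero =>
      intro s hs σ hσ hflag
      obtain rfl : s = N := hs
      exact ⟨_, σ, Exec.loop_false (hflag.2 hN.1), by simp [Expr.cost], hσ⟩
    | succ r ih =>
      intro s hs σ hσ hflag
      have hne : labels G s ≠ labels G (s + 1) := fun h => by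
        have := hN.2 h
        omega
      obtain ⟨hm, h1, hadj, hrun⟩ := hσ
      obtain ⟨t₁, σ₁, he₁, ht₁, hσ₁, hflag₁⟩ := h₂ m G (s + 1)
        (σ.setVar 1 (Expr.eval σ (.add (.var 1) (.const 1))))
        ⟨by rw [Memory.setVar_var_of_ne _ _ (by omega), hm], by simp [Expr.eval, h1], hadj, hrun⟩
      obtain ⟨t₂, σ₂, he₂, ht₂, hσ₂⟩ := ih (s + 1) (by omega) σ₁ hσ₁ hflag₁
      refine ⟨_, σ₂, Exec.loop_true (fun h => hne (hflag.1 h))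
        (Exec.seq (Exec.assign _ _ _) he₁) he₂, ?_, hσ₂⟩
      simp only [Expr.cost]
      rw [Nat.succ_mul]
      omega
  obtain ⟨t₁, σ₁, he₁, ht₁, hσ₁⟩ := h₁ m G
  obtain ⟨t₂, σ₂, he₂, ht₂, hσ₂, hflag₂⟩ := h₂ m G 0 σ₁ hσ₁
  obtain ⟨t₃, σ₃, he₃, ht₃, hσ₃⟩ := hloop N 0 (by omega) σ₂ hσ₂ hflag₂
  obtain ⟨t₄, σ₄, he₄, ht₄, ⟨hm, h1, -, hrun⟩, hpart⟩ := h₃ m G N σ₃ hσ₃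
  refine ⟨_, σ₄, Exec.seq he₁ (Exec.seq he₂ (Exec.seq he₃ he₄)), ?_, ?_, ?_, ?_, ?_⟩
  · have hmul : N * (p₂.eval m + 6) ≤ m ^ 2 * (p₂.eval m + 6) := Nat.mul_le_mul_right _ hNm
    simp only [Polynomial.eval_add, Polynomial.eval_mul, Polynomial.eval_pow, Polynomial.eval_X,
      Polynomial.eval_C]
    omega
  · rwa [h1]
  · rwa [h1]
  · intro i j hij
    rw [hpart, truth_of ((sameClassA1'_iff hN hNm i j).1 hij)]
  · intro i j hij
    rw [hpart, truth_of_not fun h => hij ((sameClassA1'_iff hN hNm i j).2 h)]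

end Program

end GraphDyn

open GraphDyn in
theorem theorem6 :
    -- A1' is polynomial in the number `m` of vertices
    (∃ (prog : Program) (p : Polynomial ℕ),
      ∀ (m : ℕ) (G : SimpleGraph (Fin m)) [DecidableRel G.Adj],
        ∃ (t : ℕ) (σ : Memory),
          Exec prog (inputMemory G) t σ ∧ t ≤ p.eval m ∧ HoldsOutput G σ) ∧
    ∀ (m : ℕ) (_ : 0 < m) (G : SimpleGraph (Fin m)) [DecidableRel G.Adj],
      -- A1' computes `C^1, …, C^{N+1}` and stops, after `N + 1 ≤ m ^ 2` steps
      (∃ N : ℕ, StopsAt G N ∧ N + 1 ≤ m ^ 2 ∧ ∀ s, N ≤ s → labels G s = labels G N) ∧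
      -- automorphism equivalent vertices are never separated by A1'
      (∀ i j : Fin m, (∃ φ : G ≃g G, φ i = j) → SameClassA1' G i j) ∧
      ∀ (J : Set ℝ) (_ : IsOpen J) (_ : J.OrdConnected) (_ : (0 : ℝ) ∈ J)
        (X : ℝ → Matrix (Fin m) (Fin m) ℝ) (_ : IsSolution G J X),
        -- different components of the solution are separated by the labels
        (∀ i r j s : Fin m, (∃ t ∈ J, X t i r ≠ X t j s) →
          ∃ k ≤ m ^ 2, labels G k i r ≠ labels G k j s) ∧
        -- A1 is covered by A1'
        (∀ i j : Fin m, SameClassA1' G i j → SameClassA1 X i j) := by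
  refine ⟨exists_program, fun m hm G _ => ?_⟩
  obtain ⟨N, hN, hle⟩ := exists_stopsAt G hm
  have hNm : N ≤ m ^ 2 := by omega
  refine ⟨⟨N, hN, hle, fun s hs => hN.eq hs⟩, fun i j => sameClassA1'_of_automorphism,
    fun J hJ hJc h0 X hX => ⟨?_, ?_⟩⟩
  · rintro i r j s ⟨t, ht, hne⟩
    exact ⟨N, hNm, fun h => hne (solution_eq_of_labels_eq hN.1 hJ hJc h0 hX h ht)⟩
  · intro i j hij n _
    obtain ⟨π, hπ⟩ := hij N hNm
    refine ⟨π, fun l => ?_⟩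
    -- Components with equal labels agree on the neighbourhood `J` of `0`, hence so do all their
    -- derivatives there.
    have heq : (fun t => X t i (π l)) =ᶠ[nhds 0] fun t => X t j l :=
      Filter.eventually_of_mem (hJ.mem_nhds h0) fun t ht =>
        solution_eq_of_labels_eq hN.1 hJ hJc h0 hX (hπ l) ht
    rw [coeffMatrix, coeffMatrix, heq.iteratedDeriv_eq]
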